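/- Let $\mathbb H$ be the real quaternions with units $i,j,k$ and modulus $|\cdot|_Q$, and let $|\cdot|$ be the Euclidean norm on $\mathbb R^2$. For $f\in L^1(\mathbb R^2,\mathbb H)$ the two-sided quaternion Fourier transform is $$\mathcal F\{f\}(\xi)=\int_{\mathbb R^2}e^{-2\pi i\,\xi_1x_1}\,f(x)\,e^{-2\pi j\,\xi_2x_2}\,dx .$$ Write $\log^+ t=\log t$ for $t>1$ and $\log^+ t=0$ for $0\le t\le 1$. Let $\alpha,\beta>0$. For a Lebesgue measurable function $f:\mathbb R^2\to\mathbb H$ and $\rho>0$ consider the conditions $$(1)\quad e^{\alpha|x|^2}f\in L^1(\mathbb R^2,\mathbb H)+L^\infty(\mathbb R^2,\mathbb H),\qquad (2)_\rho\quad \int_{\mathbb R^2}\log^+\!\left(\frac{|\mathcal F\{f\}(y)\,e^{\beta|y|^2}|_Q}{\rho}\right)dy<\infty .$$ (Condition (1) implies $f\in L^1(\mathbb R^2,\mathbb H)$, so $\mathcal F\{f\}$ is defined.) (i) If $\alpha\beta>\pi^2$ and $f$ satisfies (1) and, for some $\rho>0$, $(2)_\rho$, then $f=0$ almost everywhere.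 (ii) If $\alpha\beta=\pi^2$ and $f$ satisfies (1) and, for some $\rho>0$, $(2)_\rho$, then there is a constant quaternion $C$ with $f(x)=C e^{-\alpha|x|^2}$ for almost every $x$. (iii) If $\alpha\beta<\pi^2$, then for every $\rho>0$ there are infinitely many measurable functions, no two of them equal almost everywhere, that satisfy (1) and $(2)_\rho$. -/

import Mathlib

open MeasureTheory
open scoped Quaternion

noncomputable section

namespace QFT

/-- The plane `ℝ²` with its Euclidean norm and Lebesgue measure. -/
abbrev Plane : Type := EuclideanSpace ℝ (Fin 2)

/-- The quaternion unit `i`. -/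
def qi : ℍ[ℝ] := ⟨0, 1, 0, 0⟩

/-- The quaternion unit `j`. -/
def qj : ℍ[ℝ] := ⟨0, 0, 1, 0⟩

/-- The two-sided quaternion Fourier transform
`F{f}(ξ) = ∫ exp(-i 2π ξ₁ x₁) f(x) exp(-j 2π ξ₂ x₂) dx`. -/
def qft (f : Plane → ℍ[ℝ]) (ξ : Plane) : ℍ[ℝ] :=
  ∫ x : Plane,
    NormedSpace.exp (-((2 * Real.pi * ξ 0 * x 0) • qi)) * f x *
      NormedSpace.exp (-((2 * Real.pi * ξ 1 * x 1) • qj))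

/-- Membership in `L¹(ℝ², ℍ) + L^∞(ℝ², ℍ)`. -/
def MemL1AddLinfty (g : Plane → ℍ[ℝ]) : Prop :=
  ∃ u v : Plane → ℍ[ℝ],
    MemLp u 1 (volume : Measure Plane) ∧ MemLp v ⊤ (volume : Measure Plane) ∧ g = u + v

/-- The decay condition `e^{α|x|²} f ∈ L¹ + L^∞`. -/
def SpaceCondition (α : ℝ) (f : Plane → ℍ[ℝ]) : Prop :=
  MemL1AddLinfty (fun x => Real.exp (α * ‖x‖ ^ 2) • f x)

/-- The condition `∫ log⁺(|F{f}(y) e^{β|y|²}| / ρ) dy < ∞`. The integrand is nonnegative, and the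
integral is the Lebesgue integral with values in `[0, ∞]`. -/
def FrequencyCondition (β ρ : ℝ) (f : Plane → ℍ[ℝ]) : Prop :=
  ∫⁻ y : Plane, ENNReal.ofReal (Real.posLog (‖Real.exp (β * ‖y‖ ^ 2) • qft f y‖ / ρ)) < ⊤

end QFT

end

/-!
# Miyachi's theorem for the two-sided quaternion Fourier transform

The real-linear map `q ↦ i q j` is an involution of `ℍ` that commutes with left multiplication by `i`
and right multiplication by `j`. Its eigenspaces for `σ = ±1` are complex lines (`splitCoord σ`) on
which right multiplication by `j` acts as `-σ i`, so there the quaternion transform is the classical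
Fourier transform composed with a reflection of the frequency plane (`splitCoord_qft`). The norm of a
quaternion controls both coordinates, and the theorem reduces to complex-valued functions on the plane.

For complex-valued `g` with Gaussian decay of rate `α`, fix one real frequency coordinate and let the
other be complex. Completing the square shows that the transform is entire in that variable and
bounded by `C exp (π² (im ζ)² / α)`. If `β ≥ π² / α`, the product with `exp (β ζ²)` is therefore
bounded by `C exp (β (re ζ)²)`, and by Tonelli its `log⁺` is integrable on the real axis for almost
every value of the frozen coordinate. An entire function with these two properties is constant
(`eq_apply_zero_of_lintegral_posLog_lt_top`). Doing this in both coordinates gives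
`𝓕 g ξ = 𝓕 g 0 * exp (-β ‖ξ‖²)` (`HasGaussianDecay.fourier_eq`). At the critical exponent,
injectivity of the Fourier transform on `L¹` makes `g` a Gaussian; above it, the identity holds for two
different exponents, which forces `𝓕 g 0 = 0`.

The one-dimensional lemma is of Phragmén–Lindelöf type, but at the critical order and with an
integral condition instead of a bound on the axis. In the coordinate `z = exp w`, average `log⁺ ‖F‖`
over horizontal segments of length two. The averages `expSegment F` still satisfy the sub-mean value
inequality (by Jensen's formula), and on the real line they are bounded, because the integral condition
controls them. Comparison with the real parts of `exp (2 w)` and `exp (p w)` on half-strips of width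
`ψ < π / 2`, with `ψ → π / 2`, bounds them on the strip that corresponds to a quadrant, and by
reflection everywhere. The area mean value inequality then bounds `log⁺ ‖F‖` itself, and Liouville's
theorem applies.

Below the critical exponent, Gaussians of intermediate widths satisfy both conditions.
-/

open Real Set Filter Topology
open scoped FourierTransform RealInnerProductSpace

open QFT (Plane qi qj qft SpaceCondition FrequencyCondition)

/-! ### Functions below their circle means -/

/-- A continuous function on the plane that lies below its mean over every circle. -/
structure CircleSubMean (u : ℂ → ℝ) : Prop where
  cont : Continuous u
  le_circleAverage : ∀ (c : ℂ) (r : ℝ), 0 < r → u c ≤ circleAverage u c r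

/-- Jensen's formula gives `log ‖F c‖ ≤` the circle mean of `log ‖F‖` when `F c ≠ 0`; where `‖F c‖ ≤ 1`
the claim is trivial. -/
theorem circleSubMean_posLog_norm {F : ℂ → ℂ} (hF : Differentiable ℂ F) :
    CircleSubMean fun z => posLog ‖F z‖ := by
  have hcont : Continuous fun z => posLog ‖F z‖ := by
    have := hF.continuous
    fun_prop
  refine ⟨hcont, fun c r hr => ?_⟩
  rcases le_or_gt ‖F c‖ 1 with h1 | h1
  · have h0 : posLog ‖F c‖ = 0 := by
      rw [posLog_eq_zero_iff]
      simpa using h1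
    rw [h0]
    exact circleAverage_nonneg_of_nonneg fun z _ => posLog_nonneg
  · have hc : F c ≠ 0 := by
      intro h
      simp [h] at h1
      linarith
    have han : AnalyticOnNhd ℂ F (Metric.closedBall c |r|) := fun z _ => hF.analyticAt z
    have hJ := han.circleAverage_log_norm hr.ne' hc
    have hlog : posLog ‖F c‖ = Real.log ‖F c‖ := posLog_eq_log (by simpa using h1.le)
    have hsum : 0 ≤ ∑ᶠ u, (MeromorphicOn.divisor F (Metric.closedBall c |r|) u : ℝ) *
        Real.log (r * ‖c - u‖⁻¹) := by
      refine finsum_nonneg fun z => ?_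
      by_cases hz : z ∈ Metric.closedBall c |r|
      · have hd : 0 ≤ MeromorphicOn.divisor F (Metric.closedBall c |r|) z :=
          (MeromorphicOn.AnalyticOnNhd.divisor_nonneg han) z
        refine mul_nonneg (by exact_mod_cast hd) ?_
        rw [Metric.mem_closedBall, dist_comm, dist_eq_norm, abs_of_pos hr] at hz
        rcases eq_or_lt_of_le (norm_nonneg (c - z)) with h | h
        · simp [← h]
        · apply Real.log_nonneg
          rw [← div_eq_mul_inv, one_le_div h]
          exact hz
      · simp [hz]
    have hmono : circleAverage (fun z => Real.log ‖F z‖) c r ≤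
        circleAverage (fun z => posLog ‖F z‖) c r := by
      refine circleAverage_mono ?_ (hcont.continuousOn.circleIntegrable hr.le) ?_
      · exact MeromorphicOn.circleIntegrable_log_norm fun z _ => (hF.analyticAt z).meromorphicAt
      · intro z _
        exact le_max_right _ _
    rw [hlog]
    linarith

theorem circleAverage_norm_sq (c : ℂ) {r : ℝ} (hr : 0 < r) :
    circleAverage (fun z => ‖z‖ ^ 2) c r = ‖c‖ ^ 2 + r ^ 2 := by
  have hd : Differentiable ℂ fun z : ℂ => 2 * (starRingEnd ℂ) c * z +
      ((r ^ 2 - ‖c‖ ^ 2 : ℝ) : ℂ) := by fun_prop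
  have h1 : circleAverage (fun z : ℂ => 2 * (starRingEnd ℂ) c * z +
      ((r ^ 2 - ‖c‖ ^ 2 : ℝ) : ℂ)) c r = _ := hd.diffContOnCl.circleAverage
  have h2 := Complex.reCLM.circleAverage_comp_comm (hd.continuous.continuousOn.circleIntegrable
    (c := c) hr.le)
  rw [h1] at h2
  -- On the circle, `‖z‖ ^ 2` is the real part of an affine function of `z`.
  have h3 : circleAverage (fun z => ‖z‖ ^ 2) c r = circleAverage (⇑Complex.reCLM ∘
      fun z : ℂ => 2 * (starRingEnd ℂ) c * z + ((r ^ 2 - ‖c‖ ^ 2 : ℝ) : ℂ)) c r := by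
    refine circleAverage_congr_sphere fun z hz => ?_
    rw [mem_sphere_iff_norm, abs_of_pos hr] at hz
    have h4 : ‖z - c‖ ^ 2 = r ^ 2 := by rw [hz]
    simp only [← Complex.normSq_eq_norm_sq, Complex.normSq_apply, Complex.sub_re,
      Complex.sub_im, Function.comp, Complex.reCLM_apply, Complex.add_re, Complex.mul_re,
      Complex.mul_im, Complex.ofReal_re, Complex.conj_re, Complex.conj_im, Complex.re_ofNat,
      Complex.im_ofNat] at h4 ⊢
    linarith
  rw [h3, h2]
  simp only [← Complex.normSq_eq_norm_sq, Complex.normSq_apply,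
      Complex.reCLM_apply, Complex.add_re, Complex.mul_re,
      Complex.mul_im, Complex.ofReal_re, Complex.conj_re, Complex.conj_im, Complex.re_ofNat,
      Complex.im_ofNat]
  ring

/-- Maximum principle: on a compact set, a continuous function is bounded by `N` as soon as each
point either satisfies the bound or is the centre of a disc inside the set over whose boundary the
function has a mean at least as large as its central value. -/
theorem le_of_le_circleAverage {K : Set ℂ} (hK : IsCompact K) {u : ℂ → ℝ} (hu : ContinuousOn u K)
    {N : ℝ} (h : ∀ z ∈ K, u z ≤ N ∨
      ∃ r > 0, Metric.closedBall z r ⊆ K ∧ u z ≤ circleAverage u z r) :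
    ∀ z ∈ K, u z ≤ N := by
  intro z hz
  obtain ⟨D, hD0, hD⟩ := hK.isBounded.exists_pos_norm_le
  refine le_of_forall_pos_le_add fun η hη => ?_
  -- The perturbation `ε ‖z‖ ^ 2` makes the mean value inequality strict.
  obtain ⟨ε, hε, hεD⟩ : ∃ ε > 0, ε * D ^ 2 = η := ⟨η / D ^ 2, by positivity, by field_simp⟩
  have hg : ContinuousOn (fun z => u z + ε * ‖z‖ ^ 2) K := by fun_prop
  obtain ⟨m, hm, hmax⟩ := hK.exists_isMaxOn ⟨z, hz⟩ hg
  have hmN : u m ≤ N := by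
    refine (h m hm).resolve_right ?_
    rintro ⟨r, hr, hsub, hav⟩
    have hsph : Metric.sphere m |r| ⊆ K := by
      rw [abs_of_pos hr]
      exact Metric.sphere_subset_closedBall.trans hsub
    have hi1 : CircleIntegrable u m r := ContinuousOn.circleIntegrable hr.le
      (hu.mono (by rwa [abs_of_pos hr] at hsph))
    have hi2 : CircleIntegrable (fun z : ℂ => ε • ‖z‖ ^ 2) m r :=
      ContinuousOn.circleIntegrable hr.le (by fun_prop)
    have h1 : circleAverage (fun z => u z + ε • ‖z‖ ^ 2) m r ≤ u m + ε * ‖m‖ ^ 2 := by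
      refine circleAverage_mono_on_of_le_circle (hi1.add hi2) fun x hx => ?_
      exact hmax (hsph hx)
    rw [circleAverage_fun_add hi1 hi2, circleAverage_fun_smul, circleAverage_norm_sq _ hr,
      smul_eq_mul] at h1
    nlinarith [mul_pos hε (pow_pos hr 2)]
  have h2 : u z + ε * ‖z‖ ^ 2 ≤ u m + ε * ‖m‖ ^ 2 := hmax hz
  have h3 : ε * ‖m‖ ^ 2 ≤ η := by
    rw [← hεD]
    have := hD m hm
    gcongr
  have h4 : 0 ≤ ε * ‖z‖ ^ 2 := by positivity
  linarith

/-- The integral of `u` over the horizontal segment of length two centred at `z`. -/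
noncomputable def segmentIntegral (u : ℂ → ℝ) (z : ℂ) : ℝ := ∫ s in (-1 : ℝ)..1, u (z + s)

theorem continuous_segmentIntegral {u : ℂ → ℝ} (hu : Continuous u) :
    Continuous (segmentIntegral u) := by
  unfold segmentIntegral
  apply intervalIntegral.continuous_parametric_intervalIntegral_of_continuous'
  fun_prop

theorem continuous_circleAverage {u : ℂ → ℝ} (hu : Continuous u) {c : ℝ → ℂ} {r : ℝ → ℝ}
    (hc : Continuous c) (hr : Continuous r) :
    Continuous fun x => circleAverage u (c x) (r x) := by
  have h : Continuous fun x => ∫ θ in (0 : ℝ)..2 * π, u (circleMap (c x) (r x) θ) := by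
    apply intervalIntegral.continuous_parametric_intervalIntegral_of_continuous'
    simp only [circleMap]
    fun_prop
  exact h.const_smul (2 * π)⁻¹

theorem CircleSubMean.circleSubMean_segmentIntegral {u : ℂ → ℝ} (hu : CircleSubMean u) :
    CircleSubMean (segmentIntegral u) := by
  have hc := hu.cont
  refine ⟨continuous_segmentIntegral hc, fun c r hr => ?_⟩
  have h1 : circleAverage (segmentIntegral u) c r =
      ∫ s in (-1 : ℝ)..1, circleAverage u (c + s) r := by
    simp only [circleAverage_def, segmentIntegral, smul_eq_mul]
    rw [intervalIntegral.integral_const_mul]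
    congr 1
    rw [intervalIntegral.integral_of_le (by positivity), intervalIntegral.integral_of_le (by norm_num)]
    simp_rw [intervalIntegral.integral_of_le (show (0 : ℝ) ≤ 2 * π by positivity),
      intervalIntegral.integral_of_le (show (-1 : ℝ) ≤ 1 by norm_num)]
    rw [integral_integral_swap]
    · refine setIntegral_congr_fun measurableSet_Ioc fun s _ => ?_
      refine setIntegral_congr_fun measurableSet_Ioc fun θ _ => ?_
      simp only [circleMap]
      ring_nf
    · have : Continuous (Function.uncurry fun (x y : ℝ) => u (circleMap c r x + y)) := by
        simp only [circleMap]
        fun_prop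
      rw [Measure.prod_restrict]
      exact (this.continuousOn.integrableOn_compact (isCompact_Icc.prod isCompact_Icc)).mono_set
        (prod_mono Ioc_subset_Icc_self Ioc_subset_Icc_self)
  rw [h1]
  refine intervalIntegral.integral_mono_on (by norm_num) ?_ ?_ fun s _ => hu.le_circleAverage _ _ hr
  · exact (by fun_prop : Continuous fun s : ℝ => u (c + s)).intervalIntegrable _ _
  · exact (continuous_circleAverage hc (by fun_prop) continuous_const).intervalIntegrable _ _

/-! ### The area mean value inequality -/

/-- A circle-submean function lies below its mean over the unit disc; the integral over the disc is
written in polar coordinates. -/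
theorem CircleSubMean.pi_mul_le_integral_ball {u : ℂ → ℝ} (hu : CircleSubMean u) (c : ℂ) :
    π * u c ≤ ∫ z in Metric.ball (0 : ℂ) 1, u (c + z) := by
  have hc := hu.cont
  have hcont : Continuous fun p : ℝ × ℝ => p.1 * u (circleMap c p.1 p.2) := by
    simp only [circleMap]
    fun_prop
  have h1 : ∫ z in Metric.ball (0 : ℂ) 1, u (c + z) =
      ∫ p in Ioo (0 : ℝ) 1 ×ˢ Ioo (-π) π, p.1 * u (circleMap c p.1 p.2) := by
    rw [← integral_indicator Metric.isOpen_ball.measurableSet,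
      ← Complex.integral_comp_polarCoord_symm, polarCoord_target,
      ← integral_indicator (measurableSet_Ioi.prod measurableSet_Ioo),
      ← integral_indicator (measurableSet_Ioo.prod measurableSet_Ioo)]
    congr 1
    ext p
    by_cases h : p ∈ Ioo (0 : ℝ) 1 ×ˢ Ioo (-π) π
    · have h' : p ∈ Ioi (0 : ℝ) ×ˢ Ioo (-π) π := ⟨h.1.1, h.2⟩
      have hb : Complex.polarCoord.symm p ∈ Metric.ball (0 : ℂ) 1 := by
        rw [mem_ball_zero_iff, Complex.norm_polarCoord_symm, abs_of_pos h.1.1]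
        exact h.1.2
      rw [indicator_of_mem h, indicator_of_mem h', indicator_of_mem hb, smul_eq_mul,
        Complex.polarCoord_symm_apply, circleMap, Complex.exp_mul_I, Complex.ofReal_cos,
        Complex.ofReal_sin]
    · rw [indicator_of_notMem h]
      by_cases h' : p ∈ Ioi (0 : ℝ) ×ˢ Ioo (-π) π
      · have hb : Complex.polarCoord.symm p ∉ Metric.ball (0 : ℂ) 1 := by
          rw [mem_ball_zero_iff, Complex.norm_polarCoord_symm, abs_of_pos h'.1]
          exact fun hlt => h ⟨⟨h'.1, hlt⟩, h'.2⟩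
        rw [indicator_of_mem h', indicator_of_notMem hb, smul_zero]
      · rw [indicator_of_notMem h']
  have hint : IntegrableOn (fun p : ℝ × ℝ => p.1 * u (circleMap c p.1 p.2))
      (Ioo (0 : ℝ) 1 ×ˢ Ioo (-π) π) (volume.prod volume) :=
    (hcont.continuousOn.integrableOn_compact (isCompact_Icc.prod isCompact_Icc)).mono_set
        (prod_mono Ioo_subset_Icc_self Ioo_subset_Icc_self)
  have h2 : ∀ r : ℝ, ∫ θ in Ioo (-π) π, r * u (circleMap c r θ) =
      2 * π * (r * circleAverage u c r) := by
    intro r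
    rw [circleAverage_eq_integral_add (-π)]
    rw [intervalIntegral.integral_comp_add_right (fun θ => u (circleMap c r θ)), zero_add,
      show 2 * π + -π = π by ring, intervalIntegral.integral_of_le (by linarith [pi_pos]),
      ← integral_Ioc_eq_integral_Ioo, integral_const_mul, smul_eq_mul]
    field_simp
  rw [h1, Measure.volume_eq_prod, setIntegral_prod _ hint]
  simp_rw [h2]
  have hav : Continuous fun r : ℝ => circleAverage u c r :=
    continuous_circleAverage hc continuous_const continuous_id
  have h3 : π * u c = ∫ r in Ioo (0 : ℝ) 1, 2 * π * (r * u c) := by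
    rw [← integral_Ioc_eq_integral_Ioo, ← intervalIntegral.integral_of_le zero_le_one,
      intervalIntegral.integral_const_mul, intervalIntegral.integral_mul_const, integral_id]
    ring
  rw [h3]
  refine setIntegral_mono_on ?_ ?_ measurableSet_Ioo fun r hr => ?_
  · exact ((by fun_prop : Continuous fun r : ℝ => 2 * π * (r * u c)).integrableOn_Icc).mono_set
      Ioo_subset_Icc_self
  · exact ((by fun_prop : Continuous fun r : ℝ =>
      2 * π * (r * circleAverage u c r)).integrableOn_Icc).mono_set Ioo_subset_Icc_self
  · have := hu.le_circleAverage c r hr.1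
    have := hr.1.le
    gcongr

/-- The unit disc is covered by horizontal segments, so a nonnegative circle-submean function is
controlled by its segment integrals. -/
theorem CircleSubMean.le_of_segmentIntegral_le {u : ℂ → ℝ} (hu : CircleSubMean u)
    (h0 : ∀ z, 0 ≤ u z) {M : ℝ} (hM : ∀ z, segmentIntegral u z ≤ M) (c : ℂ) :
    u c ≤ 2 * M / π := by
  have hc := hu.cont
  rw [le_div_iff₀ pi_pos, mul_comm]
  refine (hu.pi_mul_le_integral_ball c).trans ?_
  set S : Set (ℝ × ℝ) := Ioc (-1 : ℝ) 1 ×ˢ Ioc (-1 : ℝ) 1 with hS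
  have hcont : Continuous fun p : ℝ × ℝ => u (c + (p.1 + p.2 * Complex.I)) := by fun_prop
  have hint : IntegrableOn (fun p : ℝ × ℝ => u (c + (p.1 + p.2 * Complex.I))) S
      (volume.prod volume) :=
    (hcont.continuousOn.integrableOn_compact (isCompact_Icc.prod isCompact_Icc)).mono_set
        (prod_mono Ioc_subset_Icc_self Ioc_subset_Icc_self)
  have h1 : ∫ z in Metric.ball (0 : ℂ) 1, u (c + z) ≤
      ∫ p in S, u (c + (p.1 + p.2 * Complex.I)) := by
    rw [← Complex.volume_preserving_equiv_real_prod.symm.setIntegral_preimage_emb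
      Complex.measurableEquivRealProd.symm.measurableEmbedding]
    have hz : ∀ p : ℝ × ℝ, Complex.measurableEquivRealProd.symm p = p.1 + p.2 * Complex.I :=
      fun p => Complex.mk_eq_add_mul_I _ _
    simp only [hz]
    refine setIntegral_mono_set hint ?_ ?_
    · exact Eventually.of_forall fun p => h0 _
    · refine LE.le.eventuallyLE fun p hp => ?_
      rw [mem_preimage, mem_ball_zero_iff] at hp
      have h2 := (Complex.abs_re_le_norm _).trans_lt hp
      have h3 := (Complex.abs_im_le_norm _).trans_lt hp
      rw [abs_lt] at h2 h3
      exact ⟨⟨h2.1, h2.2.le⟩, ⟨h3.1, h3.2.le⟩⟩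
  refine h1.trans ?_
  rw [Measure.volume_eq_prod, hS, ← Measure.prod_restrict,
    integral_prod_symm _ (by rwa [Measure.prod_restrict])]
  have h2 : ∀ y : ℝ, ∫ x in Ioc (-1 : ℝ) 1, u (c + (x + y * Complex.I)) =
      segmentIntegral u (c + y * Complex.I) := by
    intro y
    rw [segmentIntegral, intervalIntegral.integral_of_le (by norm_num)]
    congr 1
    ext x
    ring_nf
  simp only [h2]
  have h3 : 2 * M = ∫ _ in Ioc (-1 : ℝ) 1, M := by
    simp; norm_num
  rw [h3]
  refine setIntegral_mono_on ?_ (by simp) measurableSet_Ioc fun y _ => hM _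
  have := continuous_segmentIntegral hc
  exact ((by fun_prop : Continuous fun y : ℝ =>
      segmentIntegral u (c + y * Complex.I)).integrableOn_Icc).mono_set Ioc_subset_Icc_self

/-! ### Entire functions with integrable `log⁺` on the real axis -/

/-- Entire functions with `log⁺ ‖F z‖ ≤ a + B (re z)²` on the plane whose `log⁺` is integrable along
the real axis, with integral at most `I`. The constants are part of the data so that the bounds
derived from them are shared by the reflections of `F` in the coordinate axes. -/
structure IsMiyachi (a B I : ℝ) (F : ℂ → ℂ) : Prop where
  differentiable : Differentiable ℂ F
  nonneg : 0 ≤ B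
  posLog_le : ∀ z : ℂ, posLog ‖F z‖ ≤ a + B * z.re ^ 2
  integrable : Integrable fun x : ℝ => posLog ‖F x‖
  integral_le : ∫ x : ℝ, posLog ‖F x‖ ≤ I

/-- In the logarithmic coordinate `w`, with `z = exp w`, the integral of `log⁺ ‖F‖` over a horizontal
segment of length two. Rays through the origin become horizontal lines. -/
noncomputable def expSegment (F : ℂ → ℂ) : ℂ → ℝ :=
  segmentIntegral fun w => posLog ‖F (Complex.exp w)‖

/-- A bound for `expSegment F`, valid on the whole plane, when `IsMiyachi a B I F` holds. -/
noncomputable def expSegmentBound (a B I : ℝ) : ℝ := 2 * (a + B) + I + 2 * B * exp 2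

namespace IsMiyachi

variable {a B I : ℝ} {F : ℂ → ℂ}

theorem nonneg_left (h : IsMiyachi a B I F) : 0 ≤ a := by
  simpa using posLog_nonneg.trans (h.posLog_le 0)

theorem nonneg_right (h : IsMiyachi a B I F) : 0 ≤ I :=
  (integral_nonneg fun _ => posLog_nonneg).trans h.integral_le

theorem comp_neg (h : IsMiyachi a B I F) : IsMiyachi a B I fun z => F (-z) where
  differentiable := h.differentiable.comp differentiable_neg
  nonneg := h.nonneg
  posLog_le z := by simpa using h.posLog_le (-z)
  integrable := by simpa using h.integrable.comp_neg
  integral_le := by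
    have := integral_neg_eq_self (fun x : ℝ => posLog ‖F x‖) volume
    simp only [Complex.ofReal_neg] at this
    rw [this]
    exact h.integral_le

theorem conj_conj (h : IsMiyachi a B I F) :
    IsMiyachi a B I fun z => (starRingEnd ℂ) (F ((starRingEnd ℂ) z)) where
  differentiable z := by
    have h1 := (h.differentiable ((starRingEnd ℂ) z)).star_star
    rwa [Complex.star_def, Complex.conj_conj] at h1
  nonneg := h.nonneg
  posLog_le z := by simpa using h.posLog_le ((starRingEnd ℂ) z)
  integrable := by simpa using h.integrable
  integral_le := by simpa using h.integral_le

theorem circleSubMean_comp_exp (h : IsMiyachi a B I F) :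
    CircleSubMean fun w => posLog ‖F (Complex.exp w)‖ :=
  circleSubMean_posLog_norm (h.differentiable.comp Complex.differentiable_exp)

theorem circleSubMean_expSegment (h : IsMiyachi a B I F) : CircleSubMean (expSegment F) :=
  h.circleSubMean_comp_exp.circleSubMean_segmentIntegral

theorem intervalIntegrable_comp_exp (h : IsMiyachi a B I F) (w : ℂ) :
    IntervalIntegrable (fun s : ℝ => posLog ‖F (Complex.exp (w + s))‖) volume (-1) 1 := by
  have := h.differentiable.continuous
  exact (by fun_prop : Continuous fun s : ℝ => posLog ‖F (Complex.exp (w + s))‖).intervalIntegrable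
    _ _

/-- Growth of the segment integrals: the factor `cos (im w) ^ 2` records that `F` is bounded on the
imaginary axis. -/
theorem expSegment_le (h : IsMiyachi a B I F) (w : ℂ) :
    expSegment F w ≤ 2 * a + 2 * B * exp 2 * (exp (2 * w.re) * cos w.im ^ 2) := by
  have hB := h.nonneg
  have h1 : expSegment F w ≤
      ∫ _ in (-1 : ℝ)..1, (a + B * exp 2 * (exp (2 * w.re) * cos w.im ^ 2)) := by
    refine intervalIntegral.integral_mono_on (by norm_num) (h.intervalIntegrable_comp_exp w)
      (by simp) fun s hs => (h.posLog_le _).trans ?_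
    have h2 : (Complex.exp (w + s)).re ^ 2 = exp (2 * s) * (exp (2 * w.re) * cos w.im ^ 2) := by
      rw [Complex.exp_re, mul_pow, ← exp_nat_mul, ← mul_assoc, ← exp_add]
      simp
      left
      ring
    rw [h2, mul_assoc]
    have h3 : exp (2 * s) ≤ exp 2 := exp_le_exp.2 (by linarith [hs.2])
    gcongr
  refine h1.trans (le_of_eq ?_)
  simp only [intervalIntegral.integral_const, smul_eq_mul]
  ring

theorem expSegment_le_of_re_nonpos (h : IsMiyachi a B I F) {w : ℂ} (hw : w.re ≤ 0) :
    expSegment F w ≤ expSegmentBound a B I := by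
  refine (h.expSegment_le w).trans ?_
  have h1 : exp (2 * w.re) * cos w.im ^ 2 ≤ 1 * 1 :=
    mul_le_mul (exp_le_one_iff.2 (by linarith)) (cos_sq_le_one _) (sq_nonneg _) zero_le_one
  have h2 : 2 * B * exp 2 * (exp (2 * w.re) * cos w.im ^ 2) ≤ 2 * B * exp 2 * (1 * 1) :=
    mul_le_mul_of_nonneg_left h1 (by have := h.nonneg; positivity)
  unfold expSegmentBound
  linarith [h.nonneg, h.nonneg_right]

/-- On the real line the segment integral is controlled by the integral of `log⁺ ‖F‖`: the Jacobian
`exp s` of the substitution is at least one for `s ≥ 0`, and for `s ≤ 0` the function is bounded. -/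
theorem expSegment_ofReal_le (h : IsMiyachi a B I F) (σ : ℝ) :
    expSegment F σ ≤ expSegmentBound a B I := by
  have hB := h.nonneg
  have hcont : Continuous fun x : ℝ => posLog ‖F x‖ := by
    have := h.differentiable.continuous
    fun_prop
  have hcont' : Continuous fun s : ℝ => posLog ‖F (exp (σ + s) : ℝ)‖ * exp (σ + s) := by
    have := h.differentiable.continuous
    fun_prop
  have h1 : expSegment F σ ≤
      ∫ s in (-1 : ℝ)..1, ((a + B) + posLog ‖F (exp (σ + s) : ℝ)‖ * exp (σ + s)) := by
    refine intervalIntegral.integral_mono_on (by norm_num) (h.intervalIntegrable_comp_exp σ)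
      ((continuous_const.add hcont').intervalIntegrable _ _) fun s _ => ?_
    have h2 : Complex.exp (σ + s) = ((exp (σ + s) : ℝ) : ℂ) := by push_cast; rfl
    rw [h2]
    set v := posLog ‖F (exp (σ + s) : ℝ)‖
    have hv : 0 ≤ v := posLog_nonneg
    rcases le_total 0 (σ + s) with hs | hs
    · have := one_le_exp hs
      nlinarith [h.nonneg_left]
    · have h3 : v ≤ a + B * exp (σ + s) ^ 2 := by
        have h4 := h.posLog_le (exp (σ + s) : ℝ)
        rwa [Complex.ofReal_re] at h4
      have h4 : exp (σ + s) ^ 2 ≤ 1 := pow_le_one₀ (exp_pos _).le (exp_le_one_iff.2 hs)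
      have h5 : 0 ≤ v * exp (σ + s) := by positivity
      nlinarith
  have h6 : ∫ s in (-1 : ℝ)..1, posLog ‖F (exp (σ + s) : ℝ)‖ * exp (σ + s) =
      ∫ x in exp (σ + -1)..exp (σ + 1), posLog ‖F x‖ := by
    refine intervalIntegral.integral_comp_mul_deriv (f := fun s => exp (σ + s))
      (g := fun x : ℝ => posLog ‖F x‖) ?_ ?_ hcont
    · intro s _
      simpa using ((hasDerivAt_id s).const_add σ).exp
    · fun_prop
  have h7 : ∫ x in exp (σ + -1)..exp (σ + 1), posLog ‖F x‖ ≤ I := by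
    rw [intervalIntegral.integral_of_le (exp_le_exp.2 (by linarith))]
    exact (setIntegral_le_integral h.integrable
      (Eventually.of_forall fun x => posLog_nonneg)).trans h.integral_le
  rw [intervalIntegral.integral_add (by simp) (hcont'.intervalIntegrable _ _), h6] at h1
  simp only [intervalIntegral.integral_const, smul_eq_mul] at h1
  have : 0 ≤ 2 * B * exp 2 := by positivity
  unfold expSegmentBound
  linarith

end IsMiyachi

theorem CircleSubMean.sub_re {u : ℂ → ℝ} (hu : CircleSubMean u) {g : ℂ → ℂ}
    (hg : Differentiable ℂ g) : CircleSubMean fun z => u z - (g z).re := by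
  have hgc := hg.continuous
  have huc := hu.cont
  refine ⟨by fun_prop, fun c r hr => ?_⟩
  have h1 : circleAverage g c r = g c := hg.diffContOnCl.circleAverage
  have h2 : circleAverage (fun z => (g z).re) c r = (g c).re := by
    rw [← h1]
    exact Complex.reCLM.circleAverage_comp_comm (hgc.continuousOn.circleIntegrable hr.le)
  rw [circleAverage_fun_sub (huc.continuousOn.circleIntegrable hr.le)
    (ContinuousOn.circleIntegrable hr.le (by fun_prop)), h2]
  linarith [hu.le_circleAverage c r hr]

/-- Maximum principle for circle-submean functions on a rectangle with a corner at the origin. -/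
theorem CircleSubMean.le_on_rectangle {u : ℂ → ℝ} (hu : CircleSubMean u) {R ψ N : ℝ}
    (h : ∀ z : ℂ, z.re ∈ Icc 0 R → z.im ∈ Icc 0 ψ →
      z.re = 0 ∨ z.re = R ∨ z.im = 0 ∨ z.im = ψ → u z ≤ N) :
    ∀ z : ℂ, z.re ∈ Icc 0 R → z.im ∈ Icc 0 ψ → u z ≤ N := by
  intro z hz1 hz2
  refine le_of_le_circleAverage (K := Icc 0 R ×ℂ Icc 0 ψ) (isCompact_Icc.reProdIm isCompact_Icc)
    hu.cont.continuousOn (fun z hz => ?_) z ⟨hz1, hz2⟩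
  by_cases hb : z.re = 0 ∨ z.re = R ∨ z.im = 0 ∨ z.im = ψ
  · exact Or.inl (h z hz.1 hz.2 hb)
  · push Not at hb
    have hmem : z ∈ Ioo 0 R ×ℂ Ioo 0 ψ :=
      ⟨⟨lt_of_le_of_ne hz.1.1 (Ne.symm hb.1), lt_of_le_of_ne hz.1.2 hb.2.1⟩,
        ⟨lt_of_le_of_ne hz.2.1 (Ne.symm hb.2.2.1), lt_of_le_of_ne hz.2.2 hb.2.2.2⟩⟩
    obtain ⟨r, hr, hsub⟩ := Metric.nhds_basis_closedBall.mem_iff.1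
      ((isOpen_Ioo.reProdIm isOpen_Ioo).mem_nhds hmem)
    refine Or.inr ⟨r, hr, fun y hy => ?_, hu.le_circleAverage z r hr⟩
    exact ⟨Ioo_subset_Icc_self (hsub hy).1, Ioo_subset_Icc_self (hsub hy).2⟩

namespace IsMiyachi

variable {a B I : ℝ} {F : ℂ → ℂ}

/-- The Phragmén–Lindelöf step. The term `exp (2 z)` compensates the growth of `expSegment F` on the
line `im z = ψ`, where it carries the factor `cos ψ ^ 2`; the term `exp (p (z - i ψ / 2))`, with `p`
strictly between `2` and `π / ψ`, outgrows `expSegment F` in the whole strip. -/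
theorem expSegment_le_add (h : IsMiyachi a B I F) {ψ : ℝ} (hψ : ψ ∈ Ioo 0 (π / 2)) {z : ℂ}
    (hx : 0 ≤ z.re) (hy : z.im ∈ Icc 0 ψ) :
    expSegment F z ≤ expSegmentBound a B I +
      2 * B * exp 2 * (cos ψ / (2 * sin ψ)) * exp (2 * z.re) := by
  have hB := h.nonneg
  have ha := h.nonneg_left
  have hI := h.nonneg_right
  obtain ⟨hψ0, hψ1⟩ := hψ
  have hsin : 0 < sin ψ := sin_pos_of_pos_of_lt_pi hψ0 (by linarith)
  have hcos : 0 < cos ψ := cos_pos_of_mem_Ioo ⟨by linarith, hψ1⟩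
  obtain ⟨p, hp2, hp⟩ : ∃ p : ℝ, 2 < p ∧ p < π / ψ :=
    exists_between (by rw [lt_div_iff₀ hψ0]; linarith)
  rw [lt_div_iff₀ hψ0] at hp
  set κ := cos (p * ψ / 2) with hκ
  have hκ0 : 0 < κ := cos_pos_of_mem_Ioo ⟨by have := mul_pos (by linarith : 0 < p) hψ0; linarith,
    by linarith⟩
  set B₂ := 2 * B * exp 2 with hB₂
  have hB₂0 : 0 ≤ B₂ := by positivity
  set δ := B₂ * (cos ψ / (2 * sin ψ)) with hδ
  have hδ0 : 0 ≤ δ := by positivity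
  refine le_of_forall_pos_le_add fun η hη => ?_
  obtain ⟨ε, hε, hεη⟩ : ∃ ε > 0, ε * exp (p * z.re) = η :=
    ⟨η / exp (p * z.re), by positivity, by field_simp⟩
  obtain ⟨R, hRz, hR⟩ : ∃ R, z.re ≤ R ∧ B₂ / (ε * κ) ≤ exp ((p - 2) * R) := by
    have : Tendsto (fun R : ℝ => exp ((p - 2) * R)) atTop atTop :=
      tendsto_exp_atTop.comp (tendsto_id.const_mul_atTop (by linarith))
    exact ((eventually_ge_atTop z.re).and (this.eventually_ge_atTop _)).exists
  have hR' : B₂ * exp (2 * R) ≤ ε * κ * exp (p * R) := by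
    rw [div_le_iff₀ (by positivity)] at hR
    calc B₂ * exp (2 * R) ≤ exp ((p - 2) * R) * (ε * κ) * exp (2 * R) := by gcongr
      _ = ε * κ * (exp ((p - 2) * R) * exp (2 * R)) := by ring
      _ = ε * κ * exp (p * R) := by rw [← exp_add]; ring_nf
  let g : ℂ → ℂ := fun z => δ * (-Complex.I * Complex.exp (2 * z)) +
    ε * Complex.exp (p * (z - (ψ / 2 : ℝ) * Complex.I))
  have hg : Differentiable ℂ g := by fun_prop
  have hgre : ∀ z : ℂ, (g z).re = δ * (exp (2 * z.re) * sin (2 * z.im)) +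
      ε * (exp (p * z.re) * cos (p * (z.im - ψ / 2))) := by
    intro z
    simp [g, Complex.exp_re, Complex.exp_im]
  have hcosle : ∀ y ∈ Icc 0 ψ, κ ≤ cos (p * (y - ψ / 2)) := by
    intro y hy
    rw [hκ, ← cos_abs (p * (y - ψ / 2))]
    refine cos_le_cos_of_nonneg_of_le_pi (abs_nonneg _) (by linarith) ?_
    have : |y - ψ / 2| ≤ ψ / 2 := abs_le.2 ⟨by linarith [hy.1], by linarith [hy.2]⟩
    rw [abs_mul, abs_of_pos (by linarith : 0 < p)]
    calc p * |y - ψ / 2| ≤ p * (ψ / 2) := by gcongr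
      _ = p * ψ / 2 := by ring
  have hsinle : ∀ y ∈ Icc 0 ψ, 0 ≤ sin (2 * y) := fun y hy =>
    sin_nonneg_of_nonneg_of_le_pi (by linarith [hy.1]) (by linarith [hy.2])
  have key := (h.circleSubMean_expSegment.sub_re hg).le_on_rectangle (R := R) (ψ := ψ)
    (N := expSegmentBound a B I) ?_ z ⟨hx, hRz⟩ hy
  · rw [hgre] at key
    have h1 : δ * (exp (2 * z.re) * sin (2 * z.im)) ≤ δ * exp (2 * z.re) := by
      have := mul_le_of_le_one_right (exp_pos (2 * z.re)).le (sin_le_one (2 * z.im))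
      gcongr
    have h2 : ε * (exp (p * z.re) * cos (p * (z.im - ψ / 2))) ≤ η := by
      rw [← hεη]
      have := mul_le_of_le_one_right (exp_pos (p * z.re)).le (cos_le_one (p * (z.im - ψ / 2)))
      gcongr
    linarith
  · intro w hw1 hw2 hw
    rw [hgre]
    have h1 : 0 ≤ δ * (exp (2 * w.re) * sin (2 * w.im)) := by
      have := hsinle _ hw2
      positivity
    have h2 : ε * κ * exp (p * w.re) ≤ ε * (exp (p * w.re) * cos (p * (w.im - ψ / 2))) := by
      rw [mul_assoc, mul_comm κ]
      have := hcosle _ hw2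
      gcongr
    have h3 : 0 ≤ ε * κ * exp (p * w.re) := by positivity
    have hbound : 2 * a ≤ expSegmentBound a B I := by
      unfold expSegmentBound
      linarith
    have hle := h.expSegment_le w
    rcases hw with hw | hw | hw | hw
    · linarith [h.expSegment_le_of_re_nonpos hw.le]
    · have h4 : exp (2 * w.re) * cos w.im ^ 2 ≤ exp (2 * w.re) :=
        mul_le_of_le_one_right (exp_pos _).le (cos_sq_le_one _)
      have h5 : B₂ * (exp (2 * w.re) * cos w.im ^ 2) ≤ B₂ * exp (2 * w.re) := by gcongr
      rw [hw] at h5 h2 hle h1 ⊢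
      linarith
    · have h4 : w = (w.re : ℂ) := Complex.ext (by simp) (by simp [hw])
      have h5 := h.expSegment_ofReal_le w.re
      rw [← h4] at h5
      linarith
    · have h4 : δ * (exp (2 * w.re) * sin (2 * w.im)) =
          B₂ * (exp (2 * w.re) * cos w.im ^ 2) := by
        rw [hw, sin_two_mul, hδ]
        field_simp
      linarith

/-- The strip `0 ≤ im z ≤ π / 2` corresponds to the closed first quadrant. Letting `ψ → π / 2` makes the
coefficient `cos ψ / (2 sin ψ)` of `expSegment_le_add` vanish; on the line `im z = π / 2` itself the
growth bound is already constant. -/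
theorem expSegment_le_of_mem_quadrant (h : IsMiyachi a B I F) {z : ℂ}
    (hy : z.im ∈ Icc 0 (π / 2)) : expSegment F z ≤ expSegmentBound a B I := by
  rcases le_total z.re 0 with hx | hx
  · exact h.expSegment_le_of_re_nonpos hx
  rcases eq_or_lt_of_le hy.2 with hy2 | hy2
  · refine (h.expSegment_le z).trans ?_
    have : 0 ≤ 2 * B * exp 2 := by have := h.nonneg; positivity
    rw [hy2, cos_pi_div_two]
    unfold expSegmentBound
    linarith [h.nonneg, h.nonneg_right]
  · have ht : Tendsto (fun ψ => expSegmentBound a B I +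
        2 * B * exp 2 * (cos ψ / (2 * sin ψ)) * exp (2 * z.re)) (𝓝[<] (π / 2))
        (𝓝 (expSegmentBound a B I)) := by
      have hc : ContinuousAt (fun ψ => expSegmentBound a B I +
          2 * B * exp 2 * (cos ψ / (2 * sin ψ)) * exp (2 * z.re)) (π / 2) := by
        have : (2 * sin (π / 2)) ≠ 0 := by simp
        fun_prop (disch := assumption)
      simpa using hc.tendsto.mono_left nhdsWithin_le_nhds
    refine ge_of_tendsto ht ?_
    have hev : ∀ᶠ ψ in 𝓝[<] (π / 2), ψ ∈ Ioo z.im (π / 2) := Ioo_mem_nhdsLT hy2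
    filter_upwards [hev] with ψ hψ
    exact h.expSegment_le_add ⟨hy.1.trans_lt hψ.1, hψ.2⟩ hx ⟨hy.1, hψ.1.le⟩

theorem expSegment_conj (z : ℂ) :
    expSegment (fun z => (starRingEnd ℂ) (F ((starRingEnd ℂ) z))) z =
      expSegment F ((starRingEnd ℂ) z) := by
  simp [expSegment, segmentIntegral, ← Complex.exp_conj]

theorem expSegment_neg (z : ℂ) :
    expSegment (fun z => F (-z)) z = expSegment F (z - π * Complex.I) := by
  unfold expSegment segmentIntegral
  congr 1
  ext s
  rw [sub_add_eq_add_sub]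
  beta_reduce
  rw [Complex.exp_sub, Complex.exp_pi_mul_I, div_neg, div_one]

theorem expSegment_sub_period (z : ℂ) (n : ℤ) :
    expSegment F (z - n * (2 * π * Complex.I)) = expSegment F z := by
  unfold expSegment segmentIntegral
  congr 1
  ext s
  rw [sub_add_eq_add_sub]
  beta_reduce
  rw [Complex.exp_sub, Complex.exp_int_mul_two_pi_mul_I, div_one]

/-- Reflections in the coordinate axes and periodicity carry the bound from the closed quadrant to
the whole plane. -/
theorem expSegment_le_expSegmentBound (h : IsMiyachi a B I F) (z : ℂ) :
    expSegment F z ≤ expSegmentBound a B I := by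
  have half : ∀ {F : ℂ → ℂ}, IsMiyachi a B I F → ∀ z : ℂ, z.im ∈ Icc (-(π / 2)) (π / 2) →
      expSegment F z ≤ expSegmentBound a B I := by
    intro F h z hz
    rcases le_total 0 z.im with h0 | h0
    · exact h.expSegment_le_of_mem_quadrant ⟨h0, hz.2⟩
    · have h1 := h.conj_conj.expSegment_le_of_mem_quadrant (z := (starRingEnd ℂ) z)
        (by rw [Complex.conj_im]; constructor <;> linarith [hz.1])
      rwa [expSegment_conj, Complex.conj_conj] at h1
  obtain ⟨n, hn, -⟩ := existsUnique_sub_zsmul_mem_Ico two_pi_pos z.im (-(π / 2))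
  rw [← expSegment_sub_period z n]
  have him : (z - n * (2 * π * Complex.I)).im = z.im - n • (2 * π) := by simp
  rw [← him] at hn
  set w := z - n * (2 * π * Complex.I)
  rcases le_total w.im (π / 2) with h1 | h1
  · exact half h w ⟨hn.1, h1⟩
  · have h2 := half h.comp_neg (w - π * Complex.I)
      (by
        have : (w - π * Complex.I).im = w.im - π := by simp
        rw [this]
        constructor <;> linarith [hn.2])
    rw [expSegment_neg] at h2
    have h3 := expSegment_sub_period (F := F) w 1
    rw [Int.cast_one, one_mul] at h3
    rwa [show w - π * Complex.I - π * Complex.I = w - 2 * π * Complex.I by ring, h3] at h2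

/-- The area mean value inequality turns the bound for the segment integrals into one for `log⁺ ‖F‖`, and
Liouville's theorem concludes. The point `0`, missed by the exponential, is treated separately. -/
theorem apply_eq_apply (h : IsMiyachi a B I F) (z w : ℂ) : F z = F w := by
  have hv : ∀ z, posLog ‖F (Complex.exp z)‖ ≤ 2 * expSegmentBound a B I / π :=
    h.circleSubMean_comp_exp.le_of_segmentIntegral_le (fun _ => posLog_nonneg)
      h.expSegment_le_expSegmentBound
  have hF : ∀ z, ‖F z‖ ≤ exp (max (2 * expSegmentBound a B I / π) a) := by
    have hlog : ∀ {t c : ℝ}, posLog t ≤ c → t ≤ exp c := fun {t c} ht => by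
      rcases le_or_gt t 0 with h0 | h0
      · exact h0.trans (exp_pos _).le
      · exact (Real.log_le_iff_le_exp h0).1 ((le_max_right _ _).trans ht)
    intro z
    rcases eq_or_ne z 0 with rfl | hz
    · refine (hlog (h.posLog_le 0)).trans (exp_le_exp.2 ?_)
      simp
    · have h1 := hv (Complex.log z)
      rw [Complex.exp_log hz] at h1
      exact (hlog h1).trans (exp_le_exp.2 (le_max_left _ _))
  refine h.differentiable.apply_eq_apply_of_bounded ?_ z w
  exact (isBounded_iff_forall_norm_le).2 ⟨_, by rintro _ ⟨z, rfl⟩; exact hF z⟩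

end IsMiyachi

/-- **Miyachi's lemma.** An entire function of growth `exp (B (re z)²)` whose `log⁺` has finite
integral over the real axis is constant. -/
theorem eq_apply_zero_of_lintegral_posLog_lt_top {F : ℂ → ℂ} (hF : Differentiable ℂ F) {A B : ℝ}
    (hB : 0 ≤ B) (hA : ∀ z : ℂ, ‖F z‖ ≤ A * exp (B * z.re ^ 2))
    (hI : ∫⁻ x : ℝ, ENNReal.ofReal (posLog ‖F x‖) < ⊤) (z : ℂ) : F z = F 0 := by
  have hcont := hF.continuous
  have hint : Integrable fun x : ℝ => posLog ‖F x‖ := by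
    refine ⟨(by fun_prop : Continuous fun x : ℝ => posLog ‖F x‖).aestronglyMeasurable, ?_⟩
    rw [hasFiniteIntegral_iff_ofReal (Eventually.of_forall fun _ => posLog_nonneg)]
    exact hI
  have h : IsMiyachi (posLog A) B (∫ x : ℝ, posLog ‖F x‖) F :=
    { differentiable := hF
      nonneg := hB
      posLog_le := fun z => by
        refine (posLog_le_posLog (norm_nonneg _) (hA z)).trans (posLog_mul.trans ?_)
        have h0 : 0 ≤ B * z.re ^ 2 := by positivity
        have h1 : posLog (exp (B * z.re ^ 2)) = B * z.re ^ 2 := by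
          rw [posLog_apply, Real.log_exp, max_eq_right h0]
        rw [h1]
      integrable := hint
      integral_le := le_rfl }
  exact h.apply_eq_apply z 0

/-! ### Gaussian decay and the Fourier transform -/

section Fourier

variable {V : Type*} [NormedAddCommGroup V] [InnerProductSpace ℝ V] [FiniteDimensional ℝ V]
  [MeasurableSpace V] [BorelSpace V]

/-- The Fourier transform is injective on `L¹`. -/
theorem ae_eq_of_fourier_eq {f g : V → ℂ} (hf : Integrable f) (hg : Integrable g)
    (h : 𝓕 f = 𝓕 g) : f =ᵐ[volume] g := by
  refine ae_eq_of_integral_contDiff_smul_eq hf.locallyIntegrable hg.locallyIntegrable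
    fun φ hφ hφc => ?_
  have hc : HasCompactSupport fun x => (φ x : ℂ) := hφc.comp_left (g := ((↑) : ℝ → ℂ)) (by simp)
  set ψ : SchwartzMap V ℂ := hc.toSchwartzMap (Complex.ofRealCLM.contDiff.comp hφ) with hψ
  set θ : SchwartzMap V ℂ := 𝓕⁻ ψ with hθ
  -- Test functions are Fourier transforms of Schwartz functions, to which duality applies.
  have key : ∀ {f : V → ℂ}, Integrable f → ∫ x, φ x • f x = ∫ ξ, θ ξ • 𝓕 f ξ := by
    intro f hf
    have h1 := VectorFourier.integral_fourierIntegral_smul_eq_flip (L := innerₗ V)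
      continuous_fourierChar continuous_inner (θ.integrable (μ := volume)) hf
    have h2 : ∀ x, VectorFourier.fourierIntegral 𝐞 volume (innerₗ V) (⇑θ) x = (φ x : ℂ) := by
      intro x
      have h3 : (𝓕 θ) x = ψ x := by rw [hθ, FourierTransform.fourier_fourierInv_eq]
      rw [SchwartzMap.fourier_coe] at h3
      exact h3
    have h4 : VectorFourier.fourierIntegral 𝐞 volume (innerₗ V).flip f = 𝓕 f := by
      rw [flip_innerₗ]
      rfl
    rw [h4] at h1
    simp only [h2] at h1
    simpa using h1
  rw [key hf, key hg, h]

/-- The pointwise form of the condition `exp (α ‖x‖²) g ∈ L¹ + L^∞`. -/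
def HasGaussianDecay {E : Type*} [NormedAddCommGroup E] (α : ℝ) (g : V → E) : Prop :=
  AEStronglyMeasurable g ∧ ∃ (u : V → ℝ) (C : ℝ), Integrable u ∧ 0 ≤ C ∧
    ∀ᵐ x, ‖g x‖ ≤ exp (-α * ‖x‖ ^ 2) * (|u x| + C)

theorem integrable_rexp_neg_mul_sq_norm {α : ℝ} (hα : 0 < α) :
    Integrable fun x : V => exp (-α * ‖x‖ ^ 2) := by
  have h := (GaussianFourier.integrable_cexp_neg_mul_sq_norm_add (V := V) (b := α) (by simpa)
    0 0).norm
  refine h.congr (Eventually.of_forall fun x => ?_)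
  simp only [Complex.norm_exp]
  congr 1
  simp [← Complex.ofReal_pow]

theorem HasGaussianDecay.integrable {E : Type*} [NormedAddCommGroup E] {α : ℝ} {g : V → E}
    (h : HasGaussianDecay α g) (hα : 0 < α) : Integrable g := by
  obtain ⟨hm, u, K, hu, hK, hle⟩ := h
  have hgi := integrable_rexp_neg_mul_sq_norm (V := V) hα
  refine (hu.abs.add (hgi.const_mul K)).mono' hm ?_
  filter_upwards [hle] with x hx
  refine hx.trans ?_
  have : exp (-α * ‖x‖ ^ 2) ≤ 1 := exp_le_one_iff.2 (by have := sq_nonneg ‖x‖; nlinarith)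
  have := mul_le_of_le_one_left (abs_nonneg (u x)) this
  simp only [Pi.add_apply]
  linarith

theorem HasGaussianDecay.clm_comp {E E' : Type*} [NormedAddCommGroup E] [NormedSpace ℝ E]
    [NormedAddCommGroup E'] [NormedSpace ℝ E'] {α : ℝ} {g : V → E} (h : HasGaussianDecay α g)
    (T : E →L[ℝ] E') : HasGaussianDecay α fun x => T (g x) := by
  obtain ⟨hm, u, K, hu, hK, hle⟩ := h
  refine ⟨T.continuous.comp_aestronglyMeasurable hm, fun x => ‖T‖ * u x, ‖T‖ * K,
    hu.const_mul _, by positivity, ?_⟩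
  filter_upwards [hle] with x hx
  calc ‖T (g x)‖ ≤ ‖T‖ * ‖g x‖ := T.le_opNorm _
    _ ≤ ‖T‖ * (exp (-α * ‖x‖ ^ 2) * (|u x| + K)) := by gcongr
    _ = exp (-α * ‖x‖ ^ 2) * (|‖T‖ * u x| + ‖T‖ * K) := by
      rw [abs_mul, abs_norm]
      ring

namespace HasGaussianDecay

variable {α : ℝ} {g : V → ℂ}

/-- Completing the square: an exponential weight in the direction `e` costs `exp (π² η² / α)`, and
turns the Gaussian bound into a translated Gaussian bound. -/
theorem exists_integrable_weight (h : HasGaussianDecay α g) (hα : 0 < α) {e : V} (he : ‖e‖ = 1) :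
    ∃ C : ℝ, ∀ η : ℝ, Integrable (fun x => ‖g x‖ * exp (2 * π * η * ⟪x, e⟫)) ∧
      ∫ x, ‖g x‖ * exp (2 * π * η * ⟪x, e⟫) ≤ C * exp (π ^ 2 / α * η ^ 2) := by
  obtain ⟨hm, u, K, hu, hK, hle⟩ := h
  refine ⟨(∫ x, |u x|) + K * ∫ x : V, exp (-α * ‖x‖ ^ 2), fun η => ?_⟩
  set t : V := (π * η / α) • e with ht
  have hsq : ∀ x : V, -α * ‖x‖ ^ 2 + 2 * π * η * ⟪x, e⟫ =
      π ^ 2 / α * η ^ 2 + -α * ‖x - t‖ ^ 2 := by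
    intro x
    rw [ht, norm_sub_sq_real, inner_smul_right, norm_smul, he, mul_one, Real.norm_eq_abs, sq_abs]
    field_simp
    ring
  set E := exp (π ^ 2 / α * η ^ 2) with hE
  have hbd : ∀ᵐ x, ‖g x‖ * exp (2 * π * η * ⟪x, e⟫) ≤
      E * (|u x| + K * exp (-α * ‖x - t‖ ^ 2)) := by
    filter_upwards [hle] with x hx
    calc ‖g x‖ * exp (2 * π * η * ⟪x, e⟫)
        ≤ exp (-α * ‖x‖ ^ 2) * (|u x| + K) * exp (2 * π * η * ⟪x, e⟫) := by gcongr
      _ = exp (-α * ‖x‖ ^ 2 + 2 * π * η * ⟪x, e⟫) * (|u x| + K) := by rw [exp_add]; ring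
      _ = E * (exp (-α * ‖x - t‖ ^ 2) * |u x| + K * exp (-α * ‖x - t‖ ^ 2)) := by
          rw [hsq, exp_add]; ring
      _ ≤ E * (|u x| + K * exp (-α * ‖x - t‖ ^ 2)) := by
          have : exp (-α * ‖x - t‖ ^ 2) ≤ 1 :=
            exp_le_one_iff.2 (by have := sq_nonneg ‖x - t‖; nlinarith)
          gcongr
          exact mul_le_of_le_one_left (abs_nonneg _) this
  have hgi := integrable_rexp_neg_mul_sq_norm (V := V) hα
  have hi : Integrable fun x => E * (|u x| + K * exp (-α * ‖x - t‖ ^ 2)) :=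
    (hu.abs.add ((hgi.comp_sub_right t).const_mul K)).const_mul E
  have hmeas : AEStronglyMeasurable fun x => ‖g x‖ * exp (2 * π * η * ⟪x, e⟫) :=
    hm.norm.mul (by fun_prop : Continuous fun x : V =>
      exp (2 * π * η * ⟪x, e⟫)).aestronglyMeasurable
  have hint : Integrable fun x => ‖g x‖ * exp (2 * π * η * ⟪x, e⟫) := by
    refine hi.mono' hmeas ?_
    filter_upwards [hbd] with x hx
    rwa [Real.norm_of_nonneg (by positivity)]
  refine ⟨hint, (integral_mono_ae hint hi hbd).trans (le_of_eq ?_)⟩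
  rw [integral_const_mul, integral_add hu.abs ((hgi.comp_sub_right t).const_mul K),
    integral_const_mul, integral_sub_right_eq_self (fun x : V => exp (-α * ‖x‖ ^ 2)) t]
  ring

theorem mul_unimodular (h : HasGaussianDecay α g) {χ : V → ℂ} (hχ : Continuous χ)
    (hχ1 : ∀ x, ‖χ x‖ = 1) : HasGaussianDecay α fun x => χ x * g x := by
  obtain ⟨hm, u, K, hu, hK, hle⟩ := h
  refine ⟨hχ.aestronglyMeasurable.mul hm, u, K, hu, hK, ?_⟩
  filter_upwards [hle] with x hx
  rwa [norm_mul, hχ1, one_mul]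

end HasGaussianDecay

/-- The Fourier transform of `g` at the complex frequency `ζ e`. -/
noncomputable def directionalFourier (g : V → ℂ) (e : V) (ζ : ℂ) : ℂ :=
  ∫ x, Complex.exp (-2 * π * ⟪x, e⟫ * Complex.I * ζ) * g x

theorem norm_cexp_mul_I_mul (s : ℝ) (ζ : ℂ) :
    ‖Complex.exp (-2 * π * s * Complex.I * ζ)‖ = exp (2 * π * ζ.im * s) := by
  rw [Complex.norm_exp]
  congr 1
  simp
  ring

namespace HasGaussianDecay

variable {α : ℝ} {g : V → ℂ}

theorem exists_norm_directionalFourier_le (h : HasGaussianDecay α g) (hα : 0 < α) {e : V}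
    (he : ‖e‖ = 1) :
    ∃ C : ℝ, ∀ ζ : ℂ, ‖directionalFourier g e ζ‖ ≤ C * exp (π ^ 2 / α * ζ.im ^ 2) := by
  obtain ⟨C, hC⟩ := h.exists_integrable_weight hα he
  refine ⟨C, fun ζ => (norm_integral_le_integral_norm _).trans (le_trans (le_of_eq ?_) (hC ζ.im).2)⟩
  congr 1
  ext x
  rw [norm_mul, norm_cexp_mul_I_mul, mul_comm]

theorem differentiable_directionalFourier (h : HasGaussianDecay α g) (hα : 0 < α) {e : V}
    (he : ‖e‖ = 1) : Differentiable ℂ (directionalFourier g e) := by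
  obtain ⟨C, hC⟩ := h.exists_integrable_weight hα he
  intro ζ₀
  -- One unit of `N` covers the ball of radius one, the other the factor `2 π |⟪x, e⟫|` of the
  -- derivative.
  set N := |ζ₀.im| + 2 with hN
  have hmeas : ∀ ζ : ℂ, AEStronglyMeasurable fun x : V =>
      Complex.exp (-2 * π * ⟪x, e⟫ * Complex.I * ζ) * g x := fun ζ =>
    (by fun_prop : Continuous fun x : V =>
      Complex.exp (-2 * π * ⟪x, e⟫ * Complex.I * ζ)).aestronglyMeasurable.mul h.1
  refine (hasDerivAt_integral_of_dominated_loc_of_deriv_le (s := Metric.ball ζ₀ 1)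
    (F := fun ζ x => Complex.exp (-2 * π * ⟪x, e⟫ * Complex.I * ζ) * g x)
    (F' := fun ζ x => Complex.exp (-2 * π * ⟪x, e⟫ * Complex.I * ζ) *
      (-2 * π * ⟪x, e⟫ * Complex.I) * g x)
    (bound := fun x => ‖g x‖ * exp (2 * π * N * ⟪x, e⟫) + ‖g x‖ * exp (2 * π * (-N) * ⟪x, e⟫))
    (Metric.ball_mem_nhds _ one_pos) (Eventually.of_forall hmeas) ?_ ?_ ?_
    ((hC N).1.add (hC (-N)).1) ?_).2.differentiableAt
  · refine (hC ζ₀.im).1.mono' (hmeas _) (Eventually.of_forall fun x => ?_)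
    rw [norm_mul, norm_cexp_mul_I_mul, mul_comm]
  · exact (by fun_prop : Continuous fun x : V => Complex.exp (-2 * π * ⟪x, e⟫ * Complex.I * ζ₀) *
      (-2 * π * ⟪x, e⟫ * Complex.I)).aestronglyMeasurable.mul h.1
  · refine Eventually.of_forall fun x ζ hζ => ?_
    set s := ⟪x, e⟫
    have him : |ζ.im| ≤ |ζ₀.im| + 1 := by
      have h1 : |(ζ - ζ₀).im| ≤ ‖ζ - ζ₀‖ := Complex.abs_im_le_norm _
      rw [mem_ball_iff_norm] at hζ
      rw [Complex.sub_im] at h1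
      have h2 := abs_sub_abs_le_abs_sub ζ.im ζ₀.im
      linarith
    have h1 : ‖(-2 * π * s * Complex.I : ℂ)‖ = 2 * π * |s| := by
      simp [abs_of_pos pi_pos]
    have h2 : 2 * π * |s| ≤ exp (2 * π * |s|) := by
      linarith [add_one_le_exp (2 * π * |s|)]
    have h3 : exp (2 * π * ζ.im * s) ≤ exp (2 * π * (|ζ₀.im| + 1) * |s|) := by
      apply exp_le_exp.2
      calc 2 * π * ζ.im * s ≤ |2 * π * ζ.im * s| := le_abs_self _
        _ = 2 * π * |ζ.im| * |s| := by rw [abs_mul, abs_mul, abs_of_pos two_pi_pos]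
        _ ≤ 2 * π * (|ζ₀.im| + 1) * |s| := by gcongr
    have h4 : exp (2 * π * N * |s|) ≤ exp (2 * π * N * s) + exp (2 * π * (-N) * s) := by
      rcases abs_cases s with ⟨hs, _⟩ | ⟨hs, _⟩
      · rw [hs]
        linarith [exp_pos (2 * π * (-N) * s)]
      · rw [hs, show 2 * π * N * -s = 2 * π * (-N) * s by ring]
        linarith [exp_pos (2 * π * N * s)]
    rw [norm_mul, norm_mul, norm_cexp_mul_I_mul, h1]
    calc exp (2 * π * ζ.im * s) * (2 * π * |s|) * ‖g x‖
        ≤ exp (2 * π * (|ζ₀.im| + 1) * |s|) * exp (2 * π * |s|) * ‖g x‖ := by gcongr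
      _ = exp (2 * π * N * |s|) * ‖g x‖ := by rw [← exp_add, hN]; ring_nf
      _ ≤ (exp (2 * π * N * s) + exp (2 * π * (-N) * s)) * ‖g x‖ := by gcongr
      _ = ‖g x‖ * exp (2 * π * N * s) + ‖g x‖ * exp (2 * π * (-N) * s) := by ring
  · refine Eventually.of_forall fun x ζ _ => ?_
    have h1 : HasDerivAt (fun ζ : ℂ => -2 * π * ⟪x, e⟫ * Complex.I * ζ)
        (-2 * π * ⟪x, e⟫ * Complex.I) ζ := by
      simpa using (hasDerivAt_id ζ).const_mul (-2 * π * ⟪x, e⟫ * Complex.I : ℂ)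
    exact h1.cexp.mul_const (g x)

/-- Miyachi's theorem on a line: if `exp (β t²) 𝓕 g (ξ + t e)` has integrable `log⁺`, with `β` at least
the critical value `π² / α`, then it does not depend on `t`. -/
theorem fourier_line_eq (h : HasGaussianDecay α g) (hα : 0 < α) {e : V} (he : ‖e‖ = 1) {β ρ : ℝ}
    (hβ : π ^ 2 / α ≤ β) (hρ : 0 < ρ) {ξ : V}
    (hI : ∫⁻ t : ℝ, ENNReal.ofReal (posLog (exp (β * t ^ 2) * ‖𝓕 g (ξ + t • e)‖ / ρ)) < ⊤)
    (t : ℝ) : exp (β * t ^ 2) * 𝓕 g (ξ + t • e) = 𝓕 g ξ := by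
  have hβ0 : 0 ≤ β := le_trans (by positivity) hβ
  -- The real frequency `ξ` is moved into a unimodular factor of `g`.
  set χ : V → ℂ := fun x => Complex.exp ((-2 * π * ⟪x, ξ⟫ : ℝ) * Complex.I) with hχ
  have hd : HasGaussianDecay α fun x => χ x * g x :=
    h.mul_unimodular (by fun_prop) fun x => Complex.norm_exp_ofReal_mul_I _
  set Φ := directionalFourier (fun x => χ x * g x) e with hΦ
  have hΦt : ∀ t : ℝ, Φ t = 𝓕 g (ξ + t • e) := by
    intro t
    rw [Real.fourier_eq', hΦ, directionalFourier]
    congr 1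
    ext x
    rw [hχ, ← mul_assoc, ← Complex.exp_add, inner_add_right, inner_smul_right, smul_eq_mul]
    congr 2
    push_cast
    ring
  obtain ⟨C, hC⟩ := hd.exists_norm_directionalFourier_le hα he
  set F : ℂ → ℂ := fun ζ => Complex.exp (β * ζ ^ 2) * Φ ζ / ρ with hF
  have hFt : ∀ t : ℝ, F t = exp (β * t ^ 2) * 𝓕 g (ξ + t • e) / ρ := by
    intro t
    rw [hF]
    simp only [hΦt]
    push_cast
    rfl
  have hdiff : Differentiable ℂ F := by
    have := hd.differentiable_directionalFourier hα he
    rw [← hΦ] at this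
    fun_prop
  have hbound : ∀ z : ℂ, ‖F z‖ ≤ C / ρ * exp (β * z.re ^ 2) := by
    intro z
    have h1 : ‖Complex.exp (β * z ^ 2)‖ = exp (β * z.re ^ 2) * exp (-(β * z.im ^ 2)) := by
      rw [Complex.norm_exp, ← exp_add]
      congr 1
      simp [sq]
      ring
    -- The factor `exp (-β (im z)²)` absorbs the growth of `Φ` because `π² / α ≤ β`.
    have hC0 : 0 ≤ C := by simpa using (norm_nonneg _).trans (hC 0)
    rw [hF, norm_div, norm_mul, h1, Complex.norm_real, Real.norm_of_nonneg hρ.le]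
    calc exp (β * z.re ^ 2) * exp (-(β * z.im ^ 2)) * ‖Φ z‖ / ρ
        ≤ exp (β * z.re ^ 2) * exp (-(β * z.im ^ 2)) * (C * exp (β * z.im ^ 2)) / ρ := by
          gcongr
          refine (hC z).trans ?_
          gcongr
      _ = C / ρ * exp (β * z.re ^ 2) * (exp (-(β * z.im ^ 2)) * exp (β * z.im ^ 2)) := by ring
      _ = C / ρ * exp (β * z.re ^ 2) := by rw [← exp_add]; simp
  have hI' : ∫⁻ x : ℝ, ENNReal.ofReal (posLog ‖F x‖) < ⊤ := by
    convert hI using 5 with x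
    rw [hFt, norm_div, norm_mul, Complex.norm_real, Complex.norm_real, Real.norm_of_nonneg hρ.le,
      Real.norm_of_nonneg (exp_pos _).le]
  have hconst := eq_apply_zero_of_lintegral_posLog_lt_top hdiff hβ0 hbound hI' t
  have h0 : F 0 = 𝓕 g ξ / ρ := by
    have := hFt 0
    simpa using this
  rw [hFt, h0] at hconst
  have hρ' : (ρ : ℂ) ≠ 0 := by exact_mod_cast hρ.ne'
  exact (div_left_inj' hρ').1 hconst

end HasGaussianDecay

end Fourier

/-! ### The complex theorem on the plane -/

theorem norm_sq_vec (s t : ℝ) : ‖(!₂[s, t] : Plane)‖ ^ 2 = s ^ 2 + t ^ 2 := by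
  simp [EuclideanSpace.norm_sq_eq]

theorem continuous_vec : Continuous fun p : ℝ × ℝ => (!₂[p.1, p.2] : Plane) := by
  refine (PiLp.continuous_toLp 2 _).comp (continuous_pi fun i => ?_)
  fin_cases i
  · exact continuous_fst
  · exact continuous_snd

theorem lintegral_plane {φ : Plane → ENNReal} (hφ : Measurable φ) :
    ∫⁻ y, φ y = ∫⁻ p : ℝ × ℝ, φ !₂[p.1, p.2] :=
  ((((PiLp.volume_preserving_toLp (Fin 2)).comp
    (volume_preserving_finTwoArrow ℝ).symm).lintegral_comp hφ)).symm

/-- Miyachi's theorem on the frequency side. Almost every horizontal slice and almost every vertical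
slice satisfies the one-dimensional hypothesis; continuity extends the two identities to all
slices. -/
theorem HasGaussianDecay.fourier_eq {α β ρ : ℝ} {g : Plane → ℂ} (h : HasGaussianDecay α g)
    (hα : 0 < α) (hβ : π ^ 2 / α ≤ β) (hρ : 0 < ρ)
    (hI : ∫⁻ y : Plane, ENNReal.ofReal (posLog (exp (β * ‖y‖ ^ 2) * ‖𝓕 g y‖ / ρ)) < ⊤)
    (ξ : Plane) : exp (β * ‖ξ‖ ^ 2) * 𝓕 g ξ = 𝓕 g 0 := by
  have hβ0 : 0 ≤ β := le_trans (by positivity) hβ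
  have hc : Continuous (𝓕 g) :=
    VectorFourier.fourierIntegral_continuous continuous_fourierChar continuous_inner
      (h.integrable hα)
  have hφ : Measurable fun y : Plane =>
      ENNReal.ofReal (posLog (exp (β * ‖y‖ ^ 2) * ‖𝓕 g y‖ / ρ)) := by
    have : Continuous fun y : Plane => posLog (exp (β * ‖y‖ ^ 2) * ‖𝓕 g y‖ / ρ) := by fun_prop
    exact this.measurable.ennreal_ofReal
  have hφ' : Measurable fun p : ℝ × ℝ =>
      ENNReal.ofReal (posLog (exp (β * ‖(!₂[p.1, p.2] : Plane)‖ ^ 2) * ‖𝓕 g !₂[p.1, p.2]‖ / ρ)) :=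
    hφ.comp continuous_vec.measurable
  rw [lintegral_plane hφ] at hI
  have e0 : ‖(EuclideanSpace.single 0 1 : Plane)‖ = 1 := by simp
  have e1 : ‖(EuclideanSpace.single 1 1 : Plane)‖ = 1 := by simp
  have v0 : ∀ s t : ℝ, (!₂[s, t] : Plane) = !₂[0, t] + s • EuclideanSpace.single 0 1 := by
    intro s t
    ext i
    fin_cases i <;> simp
  have v1 : ∀ s t : ℝ, (!₂[s, t] : Plane) = !₂[s, 0] + t • EuclideanSpace.single 1 1 := by
    intro s t
    ext i
    fin_cases i <;> simp
  have h0 : ∀ s t : ℝ, exp (β * s ^ 2) * 𝓕 g !₂[s, t] = 𝓕 g !₂[0, t] := by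
    intro s
    have hae : ∀ᵐ t : ℝ, exp (β * s ^ 2) * 𝓕 g !₂[s, t] = 𝓕 g !₂[0, t] := by
      rw [Measure.volume_eq_prod, lintegral_prod_symm' _ hφ'] at hI
      filter_upwards [ae_lt_top hφ'.lintegral_prod_left' hI.ne] with t ht
      rw [v0 s t]
      refine h.fourier_line_eq hα e0 hβ hρ (lt_of_le_of_lt (lintegral_mono fun s => ?_) ht) s
      rw [← v0, norm_sq_vec]
      refine ENNReal.ofReal_le_ofReal (posLog_le_posLog (by positivity) ?_)
      have : s ^ 2 ≤ s ^ 2 + t ^ 2 := by linarith [sq_nonneg t]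
      gcongr
    have h1 : Continuous fun t : ℝ => (exp (β * s ^ 2) : ℂ) * 𝓕 g !₂[s, t] :=
      continuous_const.mul (hc.comp (continuous_vec.comp (Continuous.prodMk_right s)))
    have h2 : Continuous fun t : ℝ => 𝓕 g !₂[0, t] :=
      hc.comp (continuous_vec.comp (Continuous.prodMk_right 0))
    exact congr_fun ((h1.ae_eq_iff_eq volume h2).1 hae)
  have h1 : ∀ t : ℝ, exp (β * t ^ 2) * 𝓕 g !₂[0, t] = 𝓕 g !₂[0, 0] := by
    intro t
    have hae : ∀ᵐ s : ℝ, exp (β * t ^ 2) * 𝓕 g !₂[s, t] = 𝓕 g !₂[s, 0] := by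
      rw [Measure.volume_eq_prod, lintegral_prod _ hφ'.aemeasurable] at hI
      filter_upwards [ae_lt_top hφ'.lintegral_prod_right' hI.ne] with s hs
      rw [v1 s t]
      refine h.fourier_line_eq hα e1 hβ hρ (lt_of_le_of_lt (lintegral_mono fun t => ?_) hs) t
      rw [← v1, norm_sq_vec]
      refine ENNReal.ofReal_le_ofReal (posLog_le_posLog (by positivity) ?_)
      have : t ^ 2 ≤ s ^ 2 + t ^ 2 := by linarith [sq_nonneg s]
      gcongr
    have h1 : Continuous fun s : ℝ => (exp (β * t ^ 2) : ℂ) * 𝓕 g !₂[s, t] :=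
      continuous_const.mul (hc.comp (continuous_vec.comp (Continuous.prodMk_left t)))
    have h2 : Continuous fun s : ℝ => 𝓕 g !₂[s, 0] :=
      hc.comp (continuous_vec.comp (Continuous.prodMk_left 0))
    exact congr_fun ((h1.ae_eq_iff_eq volume h2).1 hae) 0
  have hz : (!₂[0, 0] : Plane) = 0 := by
    ext i
    fin_cases i <;> simp
  have hξ : ξ = !₂[ξ 0, ξ 1] := by
    ext i
    fin_cases i <;> simp
  have h3 := h0 (ξ 0) (ξ 1)
  have h4 := h1 (ξ 1)
  rw [hz] at h4
  rw [← h4, ← h3, ← hξ, ← mul_assoc, ← Complex.ofReal_mul, ← exp_add]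
  congr 3
  conv_lhs => rw [hξ, norm_sq_vec]
  ring

theorem fourier_gaussian_plane {γ : ℝ} (hγ : 0 < γ) (c : ℂ) (ξ : Plane) :
    𝓕 (fun x : Plane => (exp (-γ * ‖x‖ ^ 2) : ℂ) * c) ξ =
      π / γ * exp (-(π ^ 2 / γ * ‖ξ‖ ^ 2)) * c := by
  have h := fourier_gaussian_innerProductSpace (V := Plane) (b := γ) (by simpa) ξ
  have h2 : 𝓕 (fun x : Plane => (exp (-γ * ‖x‖ ^ 2) : ℂ) * c) ξ =
      𝓕 (fun x : Plane => Complex.exp (-γ * ‖x‖ ^ 2)) ξ * c := by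
    rw [Real.fourier_eq', Real.fourier_eq', ← integral_mul_const]
    congr 1
    ext x
    push_cast
    simp only [smul_eq_mul]
    ring
  rw [h2, h]
  simp only [finrank_euclideanSpace, Fintype.card_fin]
  push_cast
  rw [div_self two_ne_zero, Complex.cpow_one]
  congr 3
  ring

/-- **Miyachi's theorem** on the plane for complex-valued functions. -/
theorem HasGaussianDecay.ae_eq_gaussian {α β ρ : ℝ} {g : Plane → ℂ} (h : HasGaussianDecay α g)
    (hα : 0 < α) (hβ : π ^ 2 / α ≤ β) (hρ : 0 < ρ)
    (hI : ∫⁻ y : Plane, ENNReal.ofReal (posLog (exp (β * ‖y‖ ^ 2) * ‖𝓕 g y‖ / ρ)) < ⊤) :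
    ∃ c : ℂ, (g =ᵐ[volume] fun x => exp (-α * ‖x‖ ^ 2) * c) ∧ (π ^ 2 / α < β → c = 0) := by
  have hI' : ∫⁻ y : Plane,
      ENNReal.ofReal (posLog (exp (π ^ 2 / α * ‖y‖ ^ 2) * ‖𝓕 g y‖ / ρ)) < ⊤ := by
    refine lt_of_le_of_lt (lintegral_mono fun y => ?_) hI
    refine ENNReal.ofReal_le_ofReal (posLog_le_posLog (by positivity) ?_)
    gcongr
  have hcrit := h.fourier_eq hα le_rfl hρ hI'
  have hπ : (π : ℂ) ≠ 0 := by exact_mod_cast pi_ne_zero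
  have hα' : (α : ℂ) ≠ 0 := by exact_mod_cast hα.ne'
  refine ⟨α / π * 𝓕 g 0, ?_, fun hlt => ?_⟩
  · have hi : Integrable fun x : Plane => (exp (-α * ‖x‖ ^ 2) : ℂ) * (α / π * 𝓕 g 0) :=
      (integrable_rexp_neg_mul_sq_norm hα).ofReal.mul_const _
    refine ae_eq_of_fourier_eq (h.integrable hα) hi ?_
    ext ξ
    rw [fourier_gaussian_plane hα, ← hcrit ξ]
    have h1 : (exp (-(π ^ 2 / α * ‖ξ‖ ^ 2)) : ℂ) * exp (π ^ 2 / α * ‖ξ‖ ^ 2) = 1 := by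
      rw [← Complex.ofReal_mul, ← exp_add]
      simp
    calc 𝓕 g ξ = 1 * 𝓕 g ξ := (one_mul _).symm
      _ = _ := by
        rw [← h1]
        field_simp
  · -- Two different exponents give two different decay rates for the same function.
    set e : Plane := EuclideanSpace.single 0 1
    have he : ‖e‖ = 1 := by simp [e]
    have h1 := hcrit e
    have h2 := h.fourier_eq hα hβ hρ hI e
    rw [he] at h1 h2
    have h3 : (exp (π ^ 2 / α * 1 ^ 2) : ℂ) ≠ exp (β * 1 ^ 2) := by
      intro h
      have := exp_injective (Complex.ofReal_injective h)
      linarith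
    have h4 : 𝓕 g e = 0 := by
      by_contra hne
      exact h3 (mul_right_cancel₀ hne (h1.trans h2.symm))
    rw [← h2, h4]
    simp

/-! ### Splitting the quaternions -/

/-- The coordinate of a quaternion in the eigenspace of `q ↦ i q j` for the eigenvalue `σ = ±1`.
Left multiplication by `i` becomes multiplication by `i`, and right multiplication by `j` becomes
multiplication by `-σ i`. -/
noncomputable def splitCoord (σ : ℝ) : ℍ[ℝ] →L[ℝ] ℂ :=
  LinearMap.toContinuousLinearMap
    { toFun := fun q => ⟨q.re + σ * q.imK, q.imI - σ * q.imJ⟩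
      map_add' := fun p q => by apply Complex.ext <;> simp <;> ring
      map_smul' := fun r q => by apply Complex.ext <;> simp <;> ring }

theorem splitCoord_apply (σ : ℝ) (q : ℍ[ℝ]) :
    splitCoord σ q = ⟨q.re + σ * q.imK, q.imI - σ * q.imJ⟩ := rfl

theorem norm_sq_eq_split (q : ℍ[ℝ]) :
    2 * ‖q‖ ^ 2 = ‖splitCoord 1 q‖ ^ 2 + ‖splitCoord (-1) q‖ ^ 2 := by
  rw [sq ‖q‖, ← Quaternion.normSq_eq_norm_mul_self, Quaternion.normSq_def', splitCoord_apply,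
    splitCoord_apply, ← Complex.normSq_eq_norm_sq, ← Complex.normSq_eq_norm_sq,
    Complex.normSq_mk, Complex.normSq_mk]
  ring

theorem norm_splitCoord_le {σ : ℝ} (hσ : σ = 1 ∨ σ = -1) (q : ℍ[ℝ]) :
    ‖splitCoord σ q‖ ≤ 2 * ‖q‖ := by
  have h := norm_sq_eq_split q
  refine abs_le_of_sq_le_sq' ?_ (by positivity) |>.2
  rcases hσ with rfl | rfl <;>
  nlinarith [sq_nonneg ‖splitCoord 1 q‖, sq_nonneg ‖splitCoord (-1) q‖, sq_nonneg ‖q‖]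

theorem norm_le_split (q : ℍ[ℝ]) : ‖q‖ ≤ ‖splitCoord 1 q‖ + ‖splitCoord (-1) q‖ := by
  have h := norm_sq_eq_split q
  refine abs_le_of_sq_le_sq' ?_ (by positivity) |>.2
  nlinarith [norm_nonneg (splitCoord 1 q), norm_nonneg (splitCoord (-1) q)]

theorem splitCoord_ext {p q : ℍ[ℝ]} (h1 : splitCoord 1 p = splitCoord 1 q)
    (h2 : splitCoord (-1) p = splitCoord (-1) q) : p = q := by
  have h := norm_le_split (p - q)
  rw [map_sub, map_sub, h1, h2, sub_self, sub_self, norm_zero, add_zero] at h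
  exact sub_eq_zero.1 (norm_le_zero_iff.1 h)

theorem re_qi : qi.re = 0 := rfl
theorem imI_qi : qi.imI = 1 := rfl
theorem imJ_qi : qi.imJ = 0 := rfl
theorem imK_qi : qi.imK = 0 := rfl
theorem re_qj : qj.re = 0 := rfl
theorem imI_qj : qj.imI = 0 := rfl
theorem imJ_qj : qj.imJ = 1 := rfl
theorem imK_qj : qj.imK = 0 := rfl

theorem exists_splitCoord_eq (a b : ℂ) :
    ∃ q : ℍ[ℝ], splitCoord 1 q = a ∧ splitCoord (-1) q = b := by
  refine ⟨((a.re + b.re) / 2) • (1 : ℍ[ℝ]) + ((a.im + b.im) / 2) • qi + ((b.im - a.im) / 2) • qj +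
    ((a.re - b.re) / 2) • (qi * qj), ?_, ?_⟩ <;>
  · rw [splitCoord_apply]
    apply Complex.ext <;>
    · simp [re_qi, imI_qi, imJ_qi, imK_qi, re_qj, imI_qj, imJ_qj, imK_qj]
      ring

theorem sin_abs_div_abs_mul (t : ℝ) : sin |t| / |t| * t = sin t := by
  rcases eq_or_ne t 0 with rfl | ht
  · simp
  · rcases abs_cases t with ⟨h, _⟩ | ⟨h, _⟩
    · rw [h]
      field_simp
    · rw [h, sin_neg]
      field_simp

theorem exp_neg_smul_qi (t : ℝ) :
    NormedSpace.exp (-(t • qi)) = (cos t : ℍ[ℝ]) - sin t • qi := by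
  have h1 : ‖qi‖ = 1 := by
    rw [← sq_eq_sq₀ (norm_nonneg _) zero_le_one, sq, ← Quaternion.normSq_eq_norm_mul_self,
      Quaternion.normSq_def', re_qi, imI_qi, imJ_qi, imK_qi]
    norm_num
  have hn : ‖-(t • qi)‖ = |t| := by
    rw [norm_neg, norm_smul, h1, mul_one, Real.norm_eq_abs]
  rw [Quaternion.exp_of_re_eq_zero _ (by simp [re_qi]), hn, cos_abs, smul_neg, smul_smul,
    sin_abs_div_abs_mul, sub_eq_add_neg]

theorem exp_neg_smul_qj (t : ℝ) :
    NormedSpace.exp (-(t • qj)) = (cos t : ℍ[ℝ]) - sin t • qj := by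
  have h1 : ‖qj‖ = 1 := by
    rw [← sq_eq_sq₀ (norm_nonneg _) zero_le_one, sq, ← Quaternion.normSq_eq_norm_mul_self,
      Quaternion.normSq_def', re_qj, imI_qj, imJ_qj, imK_qj]
    norm_num
  have hn : ‖-(t • qj)‖ = |t| := by
    rw [norm_neg, norm_smul, h1, mul_one, Real.norm_eq_abs]
  rw [Quaternion.exp_of_re_eq_zero _ (by simp [re_qj]), hn, cos_abs, smul_neg, smul_smul,
    sin_abs_div_abs_mul, sub_eq_add_neg]

theorem splitCoord_exp_mul_mul_exp {σ : ℝ} (hσ : σ = 1 ∨ σ = -1) (a b : ℝ) (q : ℍ[ℝ]) :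
    splitCoord σ (NormedSpace.exp (-(a • qi)) * q * NormedSpace.exp (-(b • qj))) =
      Complex.exp ((-(a - σ * b) : ℝ) * Complex.I) * splitCoord σ q := by
  rw [exp_neg_smul_qi, exp_neg_smul_qj, Complex.exp_mul_I, ← Complex.ofReal_cos,
    ← Complex.ofReal_sin, splitCoord_apply, splitCoord_apply, cos_neg, sin_neg, cos_sub, sin_sub]
  rcases hσ with rfl | rfl <;> apply Complex.ext <;>
  · simp [re_qi, imI_qi, imJ_qi, imK_qi, re_qj, imI_qj, imJ_qj, imK_qj, -Complex.ofReal_cos,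
      -Complex.ofReal_sin]
    ring

/-- The reflection of the frequency plane that matches the eigenvalue `σ = ±1`: it changes the sign of
the second coordinate for `σ = 1` and is the identity otherwise. -/
noncomputable def freqReflection (σ : ℝ) : Plane ≃ₗᵢ[ℝ] Plane :=
  LinearIsometryEquiv.piLpCongrRight 2 fun i : Fin 2 =>
    if i = 1 ∧ σ = 1 then LinearIsometryEquiv.neg ℝ else LinearIsometryEquiv.refl ℝ ℝ

theorem freqReflection_zero (σ : ℝ) (ξ : Plane) : freqReflection σ ξ 0 = ξ 0 := by
  simp [freqReflection]

theorem freqReflection_one {σ : ℝ} (hσ : σ = 1 ∨ σ = -1) (ξ : Plane) :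
    freqReflection σ ξ 1 = -σ * ξ 1 := by
  rcases hσ with rfl | rfl
  · simp [freqReflection]
  · have : ¬ ((-1 : ℝ) = 1) := by norm_num
    simp [freqReflection, this]

theorem continuous_quaternion_exp : Continuous (NormedSpace.exp : ℍ[ℝ] → ℍ[ℝ]) :=
  letI : NormedAlgebra ℚ ℍ[ℝ] := .restrictScalars ℚ ℝ ℍ[ℝ]
  NormedSpace.exp_continuous

/-- In the two eigenspaces of `q ↦ i q j` the two-sided quaternion transform is the classical Fourier
transform, up to a reflection of the frequency plane. -/
theorem splitCoord_qft {σ : ℝ} (hσ : σ = 1 ∨ σ = -1) {f : Plane → ℍ[ℝ]} (hf : Integrable f)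
    (ξ : Plane) :
    splitCoord σ (qft f ξ) = 𝓕 (fun x => splitCoord σ (f x)) (freqReflection σ ξ) := by
  have hint : Integrable fun x : Plane => NormedSpace.exp (-((2 * π * ξ 0 * x 0) • qi)) * f x *
      NormedSpace.exp (-((2 * π * ξ 1 * x 1) • qj)) := by
    have hexp := continuous_quaternion_exp
    have h1 : Continuous fun x : Plane => NormedSpace.exp (-((2 * π * ξ 0 * x 0) • qi)) := by
      fun_prop
    have h2 : Continuous fun x : Plane => NormedSpace.exp (-((2 * π * ξ 1 * x 1) • qj)) := by
      fun_prop
    refine hf.norm.mono' ((h1.aestronglyMeasurable.mul hf.1).mul h2.aestronglyMeasurable)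
      (Eventually.of_forall fun x => ?_)
    rw [norm_mul, norm_mul, Quaternion.norm_exp, Quaternion.norm_exp]
    simp [re_qi, re_qj]
  rw [qft, ← (splitCoord σ).integral_comp_comm hint, Real.fourier_eq']
  congr 1
  ext x
  rw [splitCoord_exp_mul_mul_exp hσ, smul_eq_mul]
  congr 4
  rw [PiLp.inner_apply, Fin.sum_univ_two, freqReflection_zero, freqReflection_one hσ]
  simp
  ring

theorem QFT.SpaceCondition.hasGaussianDecay {α : ℝ} {f : Plane → ℍ[ℝ]} (h : SpaceCondition α f)
    (hf : AEStronglyMeasurable f) : HasGaussianDecay α f := by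
  obtain ⟨u, v, hu, hv, huv⟩ := h
  refine ⟨hf, fun x => ‖u x‖, (eLpNormEssSup v volume).toReal, (memLp_one_iff_integrable.1 hu).norm,
    ENNReal.toReal_nonneg, ?_⟩
  have hv' : eLpNormEssSup v volume ≠ ⊤ := by
    have := hv.2
    rw [eLpNorm_exponent_top] at this
    exact this.ne
  filter_upwards [enorm_ae_le_eLpNormEssSup v volume] with x hx
  have h1 : ‖v x‖ ≤ (eLpNormEssSup v volume).toReal := by
    rw [← toReal_enorm]
    exact ENNReal.toReal_mono hv' hx
  have h2 : exp (α * ‖x‖ ^ 2) • f x = u x + v x := congr_fun huv x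
  have h3 : exp (α * ‖x‖ ^ 2) * ‖f x‖ ≤ ‖u x‖ + (eLpNormEssSup v volume).toReal := by
    rw [← Real.norm_of_nonneg (exp_pos (α * ‖x‖ ^ 2)).le, ← norm_smul, h2]
    exact (norm_add_le _ _).trans (by gcongr)
  calc ‖f x‖ = exp (-α * ‖x‖ ^ 2) * (exp (α * ‖x‖ ^ 2) * ‖f x‖) := by
        rw [← mul_assoc, ← exp_add]
        simp
    _ ≤ _ := by
        rw [abs_norm]
        gcongr

/-- Both eigencomponents inherit the space and frequency conditions, so the complex theorem applies
to each of them. -/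
theorem splitCoord_ae_eq_gaussian {α β ρ σ : ℝ} (hα : 0 < α) (hβ : π ^ 2 / α ≤ β) (hρ : 0 < ρ)
    (hσ : σ = 1 ∨ σ = -1) {f : Plane → ℍ[ℝ]} (hf : AEStronglyMeasurable f)
    (hs : SpaceCondition α f) (hF : FrequencyCondition β ρ f) :
    ∃ c : ℂ, (∀ᵐ x, splitCoord σ (f x) = exp (-α * ‖x‖ ^ 2) * c) ∧ (π ^ 2 / α < β → c = 0) := by
  have hd := hs.hasGaussianDecay hf
  have hg := hd.clm_comp (splitCoord σ)
  refine hg.ae_eq_gaussian hα hβ (by positivity : 0 < 2 * ρ) ?_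
  rw [← (freqReflection σ).measurePreserving.lintegral_comp_emb
    (freqReflection σ).toHomeomorph.measurableEmbedding]
  refine lt_of_le_of_lt (lintegral_mono fun y => ?_) hF
  refine ENNReal.ofReal_le_ofReal (posLog_le_posLog (by positivity) ?_)
  rw [← splitCoord_qft hσ (hd.integrable hα), LinearIsometryEquiv.norm_map, norm_smul,
    Real.norm_of_nonneg (exp_pos _).le, div_le_div_iff₀ (by positivity) hρ]
  have := norm_splitCoord_le hσ (qft f y)
  calc exp (β * ‖y‖ ^ 2) * ‖splitCoord σ (qft f y)‖ * ρ
      ≤ exp (β * ‖y‖ ^ 2) * (2 * ‖qft f y‖) * ρ := by gcongr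
    _ = _ := by ring

theorem exists_ae_eq_gaussian {α β ρ : ℝ} (hα : 0 < α) (hβ : π ^ 2 / α ≤ β) (hρ : 0 < ρ)
    {f : Plane → ℍ[ℝ]} (hf : AEStronglyMeasurable f)
    (hs : SpaceCondition α f) (hF : FrequencyCondition β ρ f) :
    ∃ C : ℍ[ℝ], (∀ᵐ x, f x = exp (-α * ‖x‖ ^ 2) • C) ∧ (π ^ 2 / α < β → C = 0) := by
  obtain ⟨a, ha, ha0⟩ := splitCoord_ae_eq_gaussian hα hβ hρ (Or.inl rfl) hf hs hF
  obtain ⟨b, hb, hb0⟩ := splitCoord_ae_eq_gaussian hα hβ hρ (Or.inr rfl) hf hs hF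
  obtain ⟨C, rfl, rfl⟩ := exists_splitCoord_eq a b
  refine ⟨C, ?_, fun h => splitCoord_ext (by rw [ha0 h, map_zero]) (by rw [hb0 h, map_zero])⟩
  filter_upwards [ha, hb] with x hxa hxb
  apply splitCoord_ext
  · rw [hxa, map_smul, Complex.real_smul]
  · rw [hxb, map_smul, Complex.real_smul]

/-! ### Gaussians below the critical exponent -/

/-- A real Gaussian, as a quaternion-valued function. -/
noncomputable def quaternionGaussian (γ κ : ℝ) (x : Plane) : ℍ[ℝ] :=
  exp (-γ * ‖x‖ ^ 2) • (κ : ℍ[ℝ])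

theorem continuous_quaternionGaussian (γ κ : ℝ) : Continuous (quaternionGaussian γ κ) := by
  unfold quaternionGaussian
  fun_prop

theorem spaceCondition_quaternionGaussian {α γ : ℝ} (h : α ≤ γ) (κ : ℝ) :
    SpaceCondition α (quaternionGaussian γ κ) := by
  refine ⟨0, fun x => exp (α * ‖x‖ ^ 2) • quaternionGaussian γ κ x, MemLp.zero, ?_,
    (zero_add _).symm⟩
  have hc : Continuous fun x : Plane => exp (α * ‖x‖ ^ 2) • quaternionGaussian γ κ x :=
    (by fun_prop : Continuous fun x : Plane => exp (α * ‖x‖ ^ 2)).smul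
      (continuous_quaternionGaussian γ κ)
  refine memLp_top_of_bound hc.aestronglyMeasurable |κ| (Eventually.of_forall fun x => ?_)
  rw [quaternionGaussian, smul_smul, ← exp_add, norm_smul, Real.norm_of_nonneg (exp_pos _).le,
    Quaternion.norm_coe, Real.norm_eq_abs]
  refine mul_le_of_le_one_left (abs_nonneg _) (exp_le_one_iff.2 ?_)
  nlinarith [sq_nonneg ‖x‖]

theorem norm_qft_quaternionGaussian_le {γ κ : ℝ} (hγ : 0 < γ) (hκ : 0 ≤ κ) (ξ : Plane) :
    ‖qft (quaternionGaussian γ κ) ξ‖ ≤ 2 * (π / γ * exp (-(π ^ 2 / γ * ‖ξ‖ ^ 2)) * κ) := by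
  have hi : Integrable (quaternionGaussian γ κ) := (integrable_rexp_neg_mul_sq_norm hγ).smul_const _
  have key : ∀ σ : ℝ, σ = 1 ∨ σ = -1 → ‖splitCoord σ (qft (quaternionGaussian γ κ) ξ)‖ =
      π / γ * exp (-(π ^ 2 / γ * ‖ξ‖ ^ 2)) * κ := by
    intro σ hσ
    have h1 : (fun x => splitCoord σ (quaternionGaussian γ κ x)) =
        fun x : Plane => (exp (-γ * ‖x‖ ^ 2) : ℂ) * (κ : ℂ) := by
      ext x
      rw [quaternionGaussian, map_smul, Complex.real_smul, splitCoord_apply]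
      congr 1
      apply Complex.ext <;> simp
    rw [splitCoord_qft hσ hi, h1, fourier_gaussian_plane hγ, LinearIsometryEquiv.norm_map,
      ← Complex.ofReal_div, ← Complex.ofReal_mul, ← Complex.ofReal_mul, Complex.norm_real,
      Real.norm_of_nonneg (by positivity)]
  refine (norm_le_split _).trans (le_of_eq ?_)
  rw [key 1 (Or.inl rfl), key (-1) (Or.inr rfl)]
  ring

/-- The amplitude `ρ γ / (2 π)` keeps the quotient in the frequency condition at most one, so that its
`log⁺` vanishes identically. -/
theorem frequencyCondition_quaternionGaussian {β γ ρ : ℝ} (hγ : 0 < γ) (hρ : 0 < ρ)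
    (h : β ≤ π ^ 2 / γ) : FrequencyCondition β ρ (quaternionGaussian γ (ρ * γ / (2 * π))) := by
  have hz : ∀ y : Plane, ENNReal.ofReal (posLog (‖exp (β * ‖y‖ ^ 2) •
      qft (quaternionGaussian γ (ρ * γ / (2 * π))) y‖ / ρ)) = 0 := by
    intro y
    rw [ENNReal.ofReal_eq_zero, (posLog_eq_zero_iff _).2]
    rw [abs_of_nonneg (by positivity), div_le_one hρ, norm_smul,
      Real.norm_of_nonneg (exp_pos _).le]
    have h1 : β * ‖y‖ ^ 2 + -(π ^ 2 / γ * ‖y‖ ^ 2) ≤ 0 := by nlinarith [sq_nonneg ‖y‖]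
    calc exp (β * ‖y‖ ^ 2) * ‖qft (quaternionGaussian γ (ρ * γ / (2 * π))) y‖
        ≤ exp (β * ‖y‖ ^ 2) * (2 * (π / γ * exp (-(π ^ 2 / γ * ‖y‖ ^ 2)) * (ρ * γ / (2 * π)))) := by
          gcongr
          exact norm_qft_quaternionGaussian_le hγ (by positivity) y
      _ = ρ * (exp (β * ‖y‖ ^ 2) * exp (-(π ^ 2 / γ * ‖y‖ ^ 2))) := by field_simp
      _ ≤ ρ * 1 := by
          rw [← exp_add]
          have := exp_le_one_iff.2 h1
          gcongr
      _ = ρ := mul_one ρ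
  unfold FrequencyCondition
  simp only [hz, lintegral_zero]
  exact ENNReal.zero_lt_top

/-! ### The three cases -/

theorem theorem4p1 (α β : ℝ) (hα : 0 < α) (hβ : 0 < β) :
    (∀ f : QFT.Plane → ℍ[ℝ], AEStronglyMeasurable f (volume : Measure QFT.Plane) →
      QFT.SpaceCondition α f →
      (∃ ρ : ℝ, 0 < ρ ∧ QFT.FrequencyCondition β ρ f) →
        (Real.pi ^ 2 < α * β → ∀ᵐ x ∂(volume : Measure QFT.Plane), f x = 0) ∧
        (α * β = Real.pi ^ 2 → ∃ C : ℍ[ℝ], ∀ᵐ x ∂(volume : Measure QFT.Plane),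
          f x = Real.exp (-α * ‖x‖ ^ 2) • C)) ∧
    (α * β < Real.pi ^ 2 → ∀ ρ : ℝ, 0 < ρ →
      ∃ φ : ℕ → QFT.Plane → ℍ[ℝ],
        (∀ n, AEStronglyMeasurable (φ n) (volume : Measure QFT.Plane) ∧
          QFT.SpaceCondition α (φ n) ∧ QFT.FrequencyCondition β ρ (φ n)) ∧
        (∀ m n, m ≠ n → ¬ (φ m =ᵐ[(volume : Measure QFT.Plane)] φ n))) := by
  refine ⟨fun f hf hs => ?_, fun hlt ρ hρ => ?_⟩
  · rintro ⟨ρ, hρ, hF⟩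
    refine ⟨fun h => ?_, fun h => ?_⟩
    · have h' : π ^ 2 / α < β := by rwa [div_lt_iff₀' hα]
      obtain ⟨C, hC, hC0⟩ := exists_ae_eq_gaussian hα h'.le hρ hf hs hF
      filter_upwards [hC] with x hx
      rw [hx, hC0 h', smul_zero]
    · obtain ⟨C, hC, -⟩ := exists_ae_eq_gaussian hα (by rw [div_le_iff₀' hα, h]) hρ hf hs hF
      exact ⟨C, hC⟩
  · -- Gaussians of pairwise different widths `γ n` in the interval `(α, π² / β]`.
    have hgap : 0 < π ^ 2 / β - α := by
      rw [sub_pos, lt_div_iff₀ hβ]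
      exact hlt
    let γ : ℕ → ℝ := fun n => α + (π ^ 2 / β - α) / (n + 1)
    have hαγ : ∀ n, α ≤ γ n := fun n => by
      have : 0 ≤ (π ^ 2 / β - α) / (n + 1) := by positivity
      simp only [γ]
      linarith
    have hγ0 : ∀ n, 0 < γ n := fun n => hα.trans_le (hαγ n)
    have hγβ : ∀ n, β ≤ π ^ 2 / γ n := fun n => by
      rw [le_div_iff₀ (hγ0 n), ← le_div_iff₀' hβ]
      have : (π ^ 2 / β - α) / (n + 1) ≤ π ^ 2 / β - α :=
        div_le_self hgap.le (by have : (0 : ℝ) ≤ n := n.cast_nonneg; linarith)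
      simp only [γ]
      linarith
    refine ⟨fun n => quaternionGaussian (γ n) (ρ * γ n / (2 * π)), fun n =>
      ⟨(continuous_quaternionGaussian _ _).aestronglyMeasurable,
        spaceCondition_quaternionGaussian (hαγ n) _,
        frequencyCondition_quaternionGaussian (hγ0 n) hρ (hγβ n)⟩, fun m n hmn hae => hmn ?_⟩
    have heq := congr_fun (((continuous_quaternionGaussian _ _).ae_eq_iff_eq volume
      (continuous_quaternionGaussian _ _)).1 hae) 0
    simp only [quaternionGaussian, norm_zero, ne_eq, OfNat.ofNat_ne_zero, not_false_eq_true,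
      zero_pow, mul_zero, exp_zero, one_smul, Quaternion.coe_inj] at heq
    have h2 : γ m = γ n :=
      mul_left_cancel₀ hρ.ne' ((div_left_inj' two_pi_pos.ne').1 heq)
    have h3 : (π ^ 2 / β - α) / ((m : ℝ) + 1) = (π ^ 2 / β - α) / ((n : ℝ) + 1) :=
      add_left_cancel h2
    rw [div_eq_div_iff (by positivity) (by positivity)] at h3
    have h4 := mul_left_cancel₀ hgap.ne' h3
    have h5 : (m : ℝ) = n := by linarith
    exact_mod_cast h5
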